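/- Let $S=\mathbb F_2[x,y,z,w]$ be graded with all variables in degree $1$. Let $L_3(2)$ denote the subgroup of $GL_4(\mathbb F_2)$ generated by $$A=\begin{pmatrix}1&1&1&0\\1&0&1&0\\1&1&0&0\\1&1&0&1\end{pmatrix},\qquad B=\begin{pmatrix}0&0&1&0\\0&1&0&0\\1&1&1&0\\1&1&0&1\end{pmatrix},$$ acting on the variables through the transposed matrices: with $(x_1,x_2,x_3,x_4)=(x,y,z,w)$, a matrix $g$ acts on $S$ by the algebra homomorphism with $x_i\mapsto\sum_j g_{ij}x_j$. Let $S^{L_3(2)}$ be the ring of invariants. Define the Dickson invariants $d_4,d_6,d_7\in\mathbb F_2[x,y,z]$ as the coefficients of $T^4$, $T^2$, $T$ in $\prod_{v}(T+v)$, where $v$ runs over the eight linear forms in the $\mathbb F_2$-span of $x,y,z$, and put $$d_8=w^8+w^4d_4+w^2d_6+w\,d_7+d_4^2 .$$ Let $Sq^k$ be the Steenrod squares on $S=H^*((\mathbb Z/2)^4;\mathbb F_2)$: for $f\in S$, $Sq^k f$ is the coefficient of $T^k$ in the image of $f$ under the algebra homomorphism $S\to S[T]$ with $x_i\mapsto x_i+x_i^2T$.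 Then $d_4,d_6,d_7,d_8$ are homogeneous invariants of degrees $4,6,7,8$, they are algebraically independent over $\mathbb F_2$, and there are homogeneous elements $a_8,a_9,a_{10},a_{11},a_{12},a_{13}$ of $S^{L_3(2)}$, the subscript being the degree, with $$a_9=Sq^1a_8,\quad a_{11}=Sq^2Sq^1a_8,\quad a_{12}=Sq^2a_{10},\quad a_{13}=Sq^1Sq^2a_{10},$$ such that $S^{L_3(2)}$ is a free module over $\mathbb F_2[d_4,d_6,d_7,d_8]$ with basis $$1,\ a_8,\ a_9,\ a_{10},\ a_{11},\ a_{12},\ a_{13},\ a_{21},\qquad a_{21}=a_{10}a_{11}.$$ For the same $a_i$, one may also take $a_{21}=a_8a_{13}$: this also gives a basis. -/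

import Mathlib

noncomputable section

namespace InvL32

open Matrix

/-- The polynomial ring `𝔽₂[x, y, z, w]`, with `x = X 0`, `y = X 1`, `z = X 2`, `w = X 3`. -/
abbrev S : Type := MvPolynomial (Fin 4) (ZMod 2)

/-- The first generating matrix, as an element of `GL₄(𝔽₂)` (the second matrix is its inverse). -/
def matA : GL (Fin 4) (ZMod 2) where
  val := !![1, 1, 1, 0; 1, 0, 1, 0; 1, 1, 0, 0; 1, 1, 0, 1]
  inv := !![1, 1, 1, 0; 1, 1, 0, 0; 1, 0, 1, 0; 0, 0, 1, 1]
  val_inv := by decide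
  inv_val := by decide

/-- The second generating matrix, as an element of `GL₄(𝔽₂)` (the second matrix is its inverse). -/
def matB : GL (Fin 4) (ZMod 2) where
  val := !![0, 0, 1, 0; 0, 1, 0, 0; 1, 1, 1, 0; 1, 1, 0, 1]
  inv := !![1, 1, 1, 0; 0, 1, 0, 0; 1, 0, 0, 0; 1, 0, 1, 1]
  val_inv := by decide
  inv_val := by decide

/-- The group `L₃(2)` in its non-split four-dimensional representation:
the subgroup of `GL₄(𝔽₂)` generated by the two matrices. -/
def L32 : Subgroup (GL (Fin 4) (ZMod 2)) := Subgroup.closure {matA, matB}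

/-- The linear substitution of variables attached to a matrix `g`. The group acts on the space
with basis dual to the variables through `g`, and hence on the variables through the transpose of
`g`: the variable number `i` is sent to `∑ j, g i j * X j`, the `i`-th column of `gᵀ`. -/
def substHom (g : GL (Fin 4) (ZMod 2)) : S →ₐ[ZMod 2] S :=
  MvPolynomial.aeval fun i => ∑ j, MvPolynomial.C (g.val i j) * MvPolynomial.X j

/-- The ring of invariants `𝔽₂[x, y, z, w]^G`. -/
def invariantRing (G : Subgroup (GL (Fin 4) (ZMod 2))) : Subalgebra (ZMod 2) S :=
  ⨅ g ∈ G, AlgHom.equalizer (substHom g) (AlgHom.id (ZMod 2) S)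

/-- The total Steenrod square, graded by a formal variable `T`: the ring homomorphism
with `X i ↦ X i + (X i) ^ 2 * T`. -/
def totalSq : S →ₐ[ZMod 2] Polynomial S :=
  MvPolynomial.aeval fun i =>
    Polynomial.C (MvPolynomial.X i) + Polynomial.C (MvPolynomial.X i ^ 2) * Polynomial.X

/-- The Steenrod square `Sq^k` on `𝔽₂[x, y, z, w] = H^*((ℤ/2)⁴; 𝔽₂)`. -/
def Sq (k : ℕ) (f : S) : S := (totalSq f).coeff k

/-- `∏ (T + v)`, over all the eight linear forms `v` in the `𝔽₂`-span of `x, y, z`. -/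
def dicksonPoly : Polynomial S :=
  ∏ c : Fin 3 → ZMod 2,
    (Polynomial.X + Polynomial.C (∑ i : Fin 3, MvPolynomial.C (c i) * MvPolynomial.X i.castSucc))

/-- The Dickson invariant `d₄` of `𝔽₂[x, y, z]`: the coefficient of `T^4`. -/
def d4 : S := dicksonPoly.coeff 4

/-- The Dickson invariant `d₆` of `𝔽₂[x, y, z]`: the coefficient of `T^2`. -/
def d6 : S := dicksonPoly.coeff 2

/-- The Dickson invariant `d₇` of `𝔽₂[x, y, z]`: the coefficient of `T`. -/
def d7 : S := dicksonPoly.coeff 1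

/-- The Dickson invariant of degree eight of `𝔽₂[x, y, z, w]`. -/
def d8 : S :=
  MvPolynomial.X 3 ^ 8 + MvPolynomial.X 3 ^ 4 * d4 + MvPolynomial.X 3 ^ 2 * d6
    + MvPolynomial.X 3 * d7 + d4 ^ 2

/-- The subring `𝔽₂[d₄, d₆, d₇, d₈]`. -/
def R : Subalgebra (ZMod 2) S := Algebra.adjoin (ZMod 2) {d4, d6, d7, d8}

/-- The subring `M` is a free `R`-module with basis the family `b`. -/
def IsFreeOn {ι : Type} (M : Subalgebra (ZMod 2) S) (b : ι → S) : Prop :=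
  LinearIndependent R b ∧ (Submodule.span R (Set.range b) : Set S) = (M : Set S)

end InvL32

end

/-! Two comparisons carry the proof: one after inverting `d7`, one modulo `x`, where `d7` dies.

Inverting `d7`. Since `a8` has degree one in `w` with leading coefficient `d7`, the coordinate `w`
may be traded for the invariant `a8`. In the coordinates `x, y, z, a8` the non-split action becomes
the action of GL₃(𝔽₂) on `x, y, z`, so up to powers of `d7` every invariant is a polynomial in `d4,
d6, d7, a8` (`exists_d7_pow_mul_mem_adjoin`). Dickson's theorem, needed only up to powers of `d7`,
comes from a transfer weighted by Moore determinants (`d7_pow_three_mul_mem`). The squares of `a8`,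
`a9`, `a11` are `d7 * a9`, `d7 * a11` and a combination involving `d8`, up to invariants free of
`w`; hence powers of `a8` reduce to the eight products of distinct elements among `a8, a9, a11`.
Each such product is either a proposed generator or `d7` times one plus terms already accounted for.
So an `R`-module that contains the generators and is closed under division by `d7` contains all
invariants (`invariantRing_le_of_saturated`).

Modulo `x`. The image of `R` is the ring of squares in 𝔽₂[`q2`, `c3`, `f4`], and the eight
generators become monomials representing each parity class of exponents once. Thus a combination of
generators that vanishes modulo `x` has all coefficients divisible by `d7` in `R`
(`exists_eq_d7_mul_of_rho_sum_eq_zero`). Applied repeatedly to a relation this gives independence;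
applied once to an element divisible by `d7` it shows that the span is closed under division by
`d7`, hence is everything (`isFreeOn_of_rho_eq_monomial`). -/

namespace InvL32

open MvPolynomial

/-! ### Linear substitutions and Steenrod squares -/

/-- The linear substitution of variables attached to an arbitrary `4 × 4` matrix. -/
noncomputable def lin (M : Matrix (Fin 4) (Fin 4) (ZMod 2)) : S →ₐ[ZMod 2] S :=
  aeval fun i => ∑ j, C (M i j) * X j

theorem substHom_eq_lin (g : GL (Fin 4) (ZMod 2)) : substHom g = lin g.val := rfl

theorem lin_X (M : Matrix (Fin 4) (Fin 4) (ZMod 2)) (i : Fin 4) :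
    lin M (X i) = ∑ j, C (M i j) * X j := by
  simp [lin]

/-- Substitution of variables is contravariant in the matrix, hence the reversed order. -/
theorem lin_mul (M N : Matrix (Fin 4) (Fin 4) (ZMod 2)) (f : S) :
    lin (M * N) f = lin N (lin M f) := by
  have h : lin (M * N) = (lin N).comp (lin M) := by
    ext1 i
    simp only [lin_X, AlgHom.comp_apply, map_sum, map_mul, Matrix.mul_apply, algHom_C,
      algebraMap_eq, Finset.sum_mul, Finset.mul_sum]
    rw [Finset.sum_comm]
    simp only [mul_assoc]
  rw [h, AlgHom.comp_apply]

theorem lin_one (f : S) : lin 1 f = f := by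
  have h : lin 1 = AlgHom.id (ZMod 2) S := by
    ext1 i
    simp [lin_X, Matrix.one_apply]
  rw [h, AlgHom.id_apply]

theorem totalSq_X (i : Fin 4) :
    totalSq (X i) = Polynomial.C (X i) + Polynomial.C (X i ^ 2) * Polynomial.X := by
  simp [totalSq]

/-- Squaring is additive and fixes 𝔽₂, so `x ↦ x + x²T` commutes with linear substitutions. Singular
matrices are allowed, so this also covers setting a variable to zero. -/
theorem totalSq_lin (M : Matrix (Fin 4) (Fin 4) (ZMod 2)) (f : S) :
    totalSq (lin M f) = (totalSq f).map (lin M : S →+* S) := by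
  have h : totalSq.comp (lin M) = (Polynomial.mapAlgHom (lin M)).comp totalSq := by
    ext1 i
    change totalSq (lin M (X i)) = (totalSq (X i)).map (lin M : S →+* S)
    have hC : ∀ a : ZMod 2, totalSq (C a) = Polynomial.C (C a) := fun a => by
      rw [← algebraMap_eq, AlgHom.commutes]; rfl
    have hsq : ∀ a : ZMod 2, a ^ 2 = a := ZMod.pow_card
    simp only [totalSq_X, Polynomial.map_add, Polynomial.map_mul, Polynomial.map_C,
      Polynomial.map_X, RingHom.coe_coe, map_pow (lin M), lin_X]
    rw [sum_pow_char]
    simp only [map_sum, map_mul totalSq, hC, totalSq_X, mul_pow, ← map_pow C, hsq, map_mul,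
      Finset.sum_mul, mul_add, Finset.sum_add_distrib, mul_assoc]
  have := congrArg (fun φ => φ f) h
  simpa using this

theorem Sq_lin (k : ℕ) (M : Matrix (Fin 4) (Fin 4) (ZMod 2)) (f : S) :
    Sq k (lin M f) = lin M (Sq k f) := by
  simp [Sq, totalSq_lin, Polynomial.coeff_map]

theorem Sq_zero (f : S) : Sq 0 f = f := by
  have h : ((Polynomial.aeval (0 : S)).restrictScalars (ZMod 2)).comp totalSq
      = AlgHom.id (ZMod 2) S := by
    ext1 i
    simp [totalSq_X]
  have := congrArg (fun φ => φ f) h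
  simpa [Sq, Polynomial.coeff_zero_eq_aeval_zero] using this

theorem Sq_add (k : ℕ) (f g : S) : Sq k (f + g) = Sq k f + Sq k g := by
  simp [Sq]

theorem Sq_one_mul (f g : S) : Sq 1 (f * g) = f * Sq 1 g + Sq 1 f * g := by
  have h0 := Sq_zero
  simp only [Sq] at *
  rw [map_mul, Polynomial.coeff_mul]
  simp [Finset.Nat.antidiagonal_succ, h0]

theorem Sq_two_mul (f g : S) : Sq 2 (f * g) = f * Sq 2 g + Sq 1 f * Sq 1 g + Sq 2 f * g := by
  have h0 := Sq_zero
  simp only [Sq] at *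
  rw [map_mul, Polynomial.coeff_mul]
  simp [Finset.Nat.antidiagonal_succ, h0, add_assoc]

theorem Sq_one_X (i : Fin 4) : Sq 1 (X i) = X i ^ 2 := by
  simp [Sq, totalSq_X, -map_pow]

theorem Sq_two_X (i : Fin 4) : Sq 2 (X i) = 0 := by
  simp [Sq, totalSq_X, -map_pow]

theorem Sq_one_sq (f : S) : Sq 1 (f ^ 2) = 0 := by
  rw [pow_two, Sq_one_mul]
  grind

theorem Sq_two_sq (f : S) : Sq 2 (f ^ 2) = Sq 1 f ^ 2 := by
  rw [pow_two, Sq_two_mul]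
  grind

theorem Sq_one_four (f : S) : Sq 1 (f ^ 4) = 0 := by
  rw [show f ^ 4 = (f ^ 2) ^ 2 by ring, Sq_one_sq]

theorem Sq_two_four (f : S) : Sq 2 (f ^ 4) = 0 := by
  rw [show f ^ 4 = (f ^ 2) ^ 2 by ring, Sq_two_sq, Sq_one_sq, zero_pow two_ne_zero]

/-- `Sq k` raises the degree of homogeneous polynomials by `k`. -/
theorem isHomogeneous_Sq {f : S} {n : ℕ} (hf : f.IsHomogeneous n) (k : ℕ) :
    (Sq k f).IsHomogeneous (n + k) := by
  -- Giving `T` degree `-1` makes the total square degree-preserving; this is multiplicativity of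
  -- that grading.
  have hmul : ∀ {F G : Polynomial S} {m n : ℕ}, (∀ k, (F.coeff k).IsHomogeneous (m + k)) →
      (∀ k, (G.coeff k).IsHomogeneous (n + k)) →
      ∀ k, ((F * G).coeff k).IsHomogeneous (m + n + k) := by
    intro F G m n hF hG k
    rw [Polynomial.coeff_mul]
    refine IsHomogeneous.sum _ _ _ fun p hp => ?_
    have := (hF p.1).mul (hG p.2)
    have hp := Finset.HasAntidiagonal.mem_antidiagonal.mp hp
    rwa [show m + n + k = m + p.1 + (n + p.2) by omega]
  have hX : ∀ i k, ((totalSq (X i)).coeff k).IsHomogeneous (1 + k) := by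
    intro i k
    rw [totalSq_X, Polynomial.coeff_add, Polynomial.coeff_C, Polynomial.coeff_C_mul,
      Polynomial.coeff_X]
    rcases k with _ | _ | k
    · simpa using isHomogeneous_X (ZMod 2) i
    · simpa using isHomogeneous_X_pow (R := ZMod 2) i 2
    · simpa using isHomogeneous_zero _ _ _
  have hone : ∀ k, ((1 : Polynomial S).coeff k).IsHomogeneous (0 + k) := by
    intro k
    rw [Polynomial.coeff_one]
    split_ifs with h
    · subst h; exact isHomogeneous_one _ _
    · exact isHomogeneous_zero _ _ _
  have hpow : ∀ i e k, ((totalSq (X i ^ e)).coeff k).IsHomogeneous (e + k) := by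
    intro i e
    induction e with
    | zero => simpa using hone
    | succ e ih =>
      intro k
      rw [pow_succ, map_mul]
      exact hmul ih (hX i) k
  have hprod : ∀ (s : Finset (Fin 4)) (e : Fin 4 → ℕ) k,
      ((totalSq (∏ i ∈ s, X i ^ e i)).coeff k).IsHomogeneous (∑ i ∈ s, e i + k) := by
    intro s e
    induction s using Finset.induction_on with
    | empty => simpa using hone
    | insert i s hi ih =>
      intro k
      rw [Finset.prod_insert hi, Finset.sum_insert hi, map_mul]
      exact hmul (hpow i _) ih k
  rw [f.as_sum, Sq, map_sum, Polynomial.finsetSum_coeff]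
  refine IsHomogeneous.sum _ _ _ fun d hd => ?_
  have hdeg : ∑ i, d i = n := by
    rw [← hf (mem_support_iff.mp hd), Finsupp.weight_apply, Finsupp.sum_fintype _ _ (by simp)]
    simp
  rw [monomial_eq, Finsupp.prod_fintype _ _ (by simp), ← algebraMap_eq, ← Algebra.smul_def,
    map_smul, Polynomial.coeff_smul, Algebra.smul_def, algebraMap_eq, ← hdeg]
  exact (hprod _ _ k).C_mul _

/-! ### The Dickson invariants -/

theorem univ_eq : (Finset.univ : Finset (Fin 3 → ZMod 2)) =
    {![0,0,0],![0,0,1],![0,1,0],![0,1,1],![1,0,0],![1,0,1],![1,1,0],![1,1,1]} := by decide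

/-- The Dickson invariant of degree `2` of `𝔽₂[y, z]`. -/
noncomputable def q2 : S := X 1 ^ 2 + X 1 * X 2 + X 2 ^ 2

/-- The Dickson invariant of degree `3` of `𝔽₂[y, z]`. -/
noncomputable def c3 : S := X 1 * X 2 * (X 1 + X 2)

/-- The product of `x + v` over the linear forms `v` in `y, z`. -/
noncomputable def e4 : S := X 0 ^ 4 + q2 * X 0 ^ 2 + c3 * X 0

/-- Let g(T) = T⁴ + `q2` T² + `c3` T be the product over the span of `y, z`. It is additive and g(x)
= `e4`, so the full product is g(T) g(T + x) = g(T)² + `e4` g(T). -/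
theorem dicksonPoly_eq : dicksonPoly = Polynomial.X ^ 8
    + Polynomial.C (q2 ^ 2 + e4) * Polynomial.X ^ 4
    + Polynomial.C (c3 ^ 2 + q2 * e4) * Polynomial.X ^ 2
    + Polynomial.C (c3 * e4) * Polynomial.X := by
  rw [dicksonPoly, univ_eq]
  rw [Finset.prod_insert (by decide), Finset.prod_insert (by decide),
    Finset.prod_insert (by decide), Finset.prod_insert (by decide),
    Finset.prod_insert (by decide), Finset.prod_insert (by decide),
    Finset.prod_insert (by decide), Finset.prod_singleton]
  simp only [Fin.sum_univ_three]
  simp [e4, q2, c3]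
  generalize Polynomial.C (MvPolynomial.X 0 : S) = x
  generalize Polynomial.C (MvPolynomial.X 1 : S) = y
  generalize Polynomial.C (MvPolynomial.X 2 : S) = z
  generalize (Polynomial.X : Polynomial S) = T
  grind

theorem d4_eq : d4 = q2 ^ 2 + e4 := by
  simp [d4, dicksonPoly_eq, -map_add, -map_mul, -map_pow, Polynomial.coeff_X_pow]

theorem d6_eq : d6 = c3 ^ 2 + q2 * e4 := by
  simp [d6, dicksonPoly_eq, -map_add, -map_mul, -map_pow, Polynomial.coeff_X_pow]

theorem d7_eq : d7 = c3 * e4 := by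
  simp [d7, dicksonPoly_eq, -map_add, -map_mul, -map_pow, Polynomial.coeff_X_pow]

/-! ### The invariants -/

/-- The part of degree `0` in `w` of the invariant `a8`. -/
def p8 {A : Type*} [CommRing A] (x y z : A) : A :=
  x ^ 6 * y ^ 2 + x ^ 6 * y * z + x ^ 6 * z ^ 2 + x ^ 5 * y ^ 3 + x ^ 5 * y ^ 2 * z
    + x ^ 5 * z ^ 3 + x ^ 4 * y ^ 3 * z + x ^ 4 * y * z ^ 3 + x ^ 3 * y ^ 5 + x ^ 3 * y ^ 4 * z
    + x ^ 3 * z ^ 5 + x ^ 2 * y ^ 6 + x ^ 2 * y ^ 5 * z + x ^ 2 * y ^ 4 * z ^ 2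
    + x ^ 2 * y * z ^ 5 + x ^ 2 * z ^ 6 + x * y ^ 6 * z + x * y * z ^ 6 + y ^ 6 * z ^ 2
    + y ^ 5 * z ^ 3 + y ^ 3 * z ^ 5 + y ^ 2 * z ^ 6

/-- The part of degree `0` in `w` of the invariant `a9`. -/
def p9 {A : Type*} [CommRing A] (x y z : A) : A :=
  x ^ 6 * y ^ 3 + x ^ 6 * y * z ^ 2 + x ^ 6 * z ^ 3 + x ^ 5 * y ^ 4 + x ^ 5 * y ^ 2 * z ^ 2
    + x ^ 5 * z ^ 4 + x ^ 4 * y ^ 5 + x ^ 4 * y ^ 3 * z ^ 2 + x ^ 4 * y ^ 2 * z ^ 3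
    + x ^ 4 * y * z ^ 4 + x ^ 4 * z ^ 5 + x ^ 3 * y ^ 6 + x ^ 3 * y ^ 4 * z ^ 2 + x ^ 3 * z ^ 6
    + x ^ 2 * y ^ 5 * z ^ 2 + x ^ 2 * y ^ 2 * z ^ 5 + x * y ^ 6 * z ^ 2 + x * y ^ 2 * z ^ 6
    + y ^ 6 * z ^ 3 + y ^ 5 * z ^ 4 + y ^ 4 * z ^ 5 + y ^ 3 * z ^ 6

/-- The part of degree `0` in `w` of the invariant `a10`. -/
def p10 {A : Type*} [CommRing A] (x y z : A) : A :=
  x ^ 7 * y ^ 2 * z + x ^ 7 * y * z ^ 2 + x ^ 6 * y ^ 2 * z ^ 2 + x ^ 6 * y * z ^ 3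
    + x ^ 5 * y ^ 2 * z ^ 3 + x ^ 5 * y * z ^ 4 + x ^ 4 * y ^ 5 * z + x ^ 4 * y ^ 3 * z ^ 3
    + x ^ 3 * y ^ 6 * z + x ^ 3 * y ^ 5 * z ^ 2 + x ^ 3 * y ^ 4 * z ^ 3 + x ^ 3 * y ^ 3 * z ^ 4
    + x ^ 2 * y ^ 7 * z + x ^ 2 * y ^ 5 * z ^ 3 + x ^ 2 * y ^ 4 * z ^ 4 + x ^ 2 * y * z ^ 7
    + x * y ^ 7 * z ^ 2 + x * y ^ 6 * z ^ 3 + x * y ^ 5 * z ^ 4 + x * y ^ 2 * z ^ 7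

/-- The part of degree `0` in `w` of the invariant `a11`. -/
def p11 {A : Type*} [CommRing A] (x y z : A) : A :=
  x ^ 8 * y ^ 3 + x ^ 8 * y * z ^ 2 + x ^ 8 * z ^ 3 + x ^ 6 * y ^ 5 + x ^ 6 * y * z ^ 4
    + x ^ 6 * z ^ 5 + x ^ 5 * y ^ 6 + x ^ 5 * y ^ 2 * z ^ 4 + x ^ 5 * z ^ 6
    + x ^ 4 * y ^ 4 * z ^ 3 + x ^ 4 * y ^ 3 * z ^ 4 + x ^ 3 * y ^ 8 + x ^ 3 * y ^ 4 * z ^ 4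
    + x ^ 3 * z ^ 8 + x ^ 2 * y ^ 5 * z ^ 4 + x ^ 2 * y ^ 4 * z ^ 5 + x * y ^ 8 * z ^ 2
    + x * y ^ 6 * z ^ 4 + x * y ^ 4 * z ^ 6 + x * y ^ 2 * z ^ 8 + y ^ 8 * z ^ 3 + y ^ 6 * z ^ 5
    + y ^ 5 * z ^ 6 + y ^ 3 * z ^ 8

theorem map_p8 {A B F : Type*} [CommRing A] [CommRing B] [FunLike F A B] [RingHomClass F A B]
    (φ : F) (x y z : A) : φ (p8 x y z) = p8 (φ x) (φ y) (φ z) := by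
  simp [p8]

theorem map_p10 {A B F : Type*} [CommRing A] [CommRing B] [FunLike F A B] [RingHomClass F A B]
    (φ : F) (x y z : A) : φ (p10 x y z) = p10 (φ x) (φ y) (φ z) := by
  simp [p10]

/-- The generator of degree `8` of the ring of invariants. -/
noncomputable def a8 : S := d7 * X 3 + p8 (X 0) (X 1) (X 2)

/-- The generator of degree `9` of the ring of invariants. -/
noncomputable def a9 : S := Sq 1 a8

/-- The generator of degree `10` of the ring of invariants. -/
noncomputable def a10 : S :=
  d6 * X 3 ^ 4 + d7 * X 3 ^ 3 + p8 (X 0) (X 1) (X 2) * X 3 ^ 2 + p9 (X 0) (X 1) (X 2) * X 3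
    + p10 (X 0) (X 1) (X 2)

/-- The generator of degree `11` of the ring of invariants. -/
noncomputable def a11 : S := Sq 2 a9

/-- The generator of degree `12` of the ring of invariants. -/
noncomputable def a12 : S := Sq 2 a10

/-- The generator of degree `13` of the ring of invariants. -/
noncomputable def a13 : S := Sq 1 a12

/-! ### Steenrod squares of the Dickson classes and of the generators -/

theorem Sq_one_X_pow (i : Fin 4) (n : ℕ) : Sq 1 (X i ^ n) = (n : S) * X i ^ (n + 1) := by
  induction n with
  | zero => simpa using Sq_one_sq 1
  | succ n ih =>
    rw [pow_succ, Sq_one_mul, ih, Sq_one_X]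
    push_cast
    ring

theorem Sq_two_X_pow (i : Fin 4) (n : ℕ) : Sq 2 (X i ^ n) = (n.choose 2 : S) * X i ^ (n + 2) := by
  induction n with
  | zero => simpa using Sq_two_four 1
  | succ n ih =>
    rw [pow_succ, Sq_two_mul, ih, Sq_two_X, Sq_one_X, Sq_one_X_pow, Nat.choose_succ_succ' n 1]
    simp only [Nat.choose_one_right]
    push_cast
    ring

theorem Sq_one_q2 : Sq 1 q2 = c3 := by
  simp only [q2, c3, Sq_add, Sq_one_mul, Sq_one_X_pow, Sq_one_X]
  grind

theorem Sq_two_q2 : Sq 2 q2 = q2 ^ 2 := by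
  simp only [q2, Sq_add, Sq_two_mul, Sq_two_sq, Sq_one_X, Sq_two_X]
  grind

theorem Sq_one_c3 : Sq 1 c3 = 0 := by
  simp only [c3, Sq_add, Sq_one_mul, Sq_one_X]
  grind

theorem Sq_two_c3 : Sq 2 c3 = q2 * c3 := by
  simp only [c3, q2, Sq_add, Sq_two_mul, Sq_one_mul, Sq_one_X, Sq_two_X]
  grind

theorem Sq_one_e4 : Sq 1 e4 = 0 := by
  simp only [e4, Sq_add, Sq_one_mul, Sq_one_X, Sq_one_q2, Sq_one_c3, Sq_one_sq, Sq_one_four]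
  grind

theorem Sq_two_e4 : Sq 2 e4 = q2 * e4 := by
  simp only [e4, Sq_add, Sq_two_mul, Sq_one_X, Sq_one_q2, Sq_one_c3, Sq_one_sq, Sq_two_four,
    Sq_two_X, Sq_two_q2, Sq_two_c3, Sq_two_sq]
  grind

theorem Sq_one_d7 : Sq 1 d7 = 0 := by
  rw [d7_eq, Sq_one_mul, Sq_one_c3, Sq_one_e4]
  ring

theorem Sq_two_d7 : Sq 2 d7 = 0 := by
  rw [d7_eq, Sq_two_mul, Sq_one_c3, Sq_two_c3, Sq_two_e4]
  grind

theorem Sq_one_d6 : Sq 1 d6 = d7 := by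
  rw [d6_eq, d7_eq, Sq_add, Sq_one_sq, Sq_one_mul, Sq_one_e4, Sq_one_q2]
  ring

theorem Sq_two_d6 : Sq 2 d6 = 0 := by
  rw [d6_eq, Sq_add, Sq_two_sq, Sq_two_mul, Sq_one_e4, Sq_one_q2, Sq_two_e4, Sq_two_q2, Sq_one_c3]
  grind

theorem Sq_one_p8 : Sq 1 (p8 (X 0) (X 1) (X 2)) = p9 (X 0) (X 1) (X 2) := by
  simp only [p8, p9, Sq_add, Sq_one_mul, Sq_one_X_pow, Sq_one_X]
  push_cast
  grind

theorem Sq_two_p9 : Sq 2 (p9 (X 0) (X 1) (X 2)) = p11 (X 0) (X 1) (X 2) := by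
  simp only [p9, p11, Sq_add, Sq_two_mul, Sq_one_mul, Sq_one_X_pow, Sq_two_X_pow, Sq_one_X,
    Sq_two_X, show Nat.choose 2 2 = 1 from rfl, show Nat.choose 3 2 = 3 from rfl,
    show Nat.choose 4 2 = 6 from rfl, show Nat.choose 5 2 = 10 from rfl,
    show Nat.choose 6 2 = 15 from rfl]
  push_cast
  grind

theorem a9_eq : a9 = d7 * X 3 ^ 2 + p9 (X 0) (X 1) (X 2) := by
  rw [a9, a8, Sq_add, Sq_one_mul, Sq_one_X, Sq_one_d7, Sq_one_p8]
  ring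

theorem a11_eq : a11 = d7 * X 3 ^ 4 + p11 (X 0) (X 1) (X 2) := by
  rw [a11, a9_eq, Sq_add, Sq_two_mul, Sq_two_sq, Sq_one_sq, Sq_one_X, Sq_two_d7, Sq_two_p9]
  ring

/-- The relation that governs `a10`: it yields its invariance without expanding it, and its images
under `Sq 2` and then `Sq 1` give the relations for `a12` and `a13`. Only the part free of `w` needs
a computation. -/
theorem d7_mul_a10 : d7 * a10 = a8 * a9 + d6 * a11 := by
  have h : d7 * p10 (X 0) (X 1) (X 2) = p8 (X 0) (X 1) (X 2) * p9 (X 0) (X 1) (X 2)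
      + d6 * p11 (X 0) (X 1) (X 2) := by
    simp only [d7_eq, d6_eq, p8, p9, p10, p11, e4, c3, q2]
    grind
  rw [a9_eq, a11_eq, a10, a8]
  linear_combination h

theorem linearForm_root (c : Fin 3 → ZMod 2) :
    (∑ i : Fin 3, C (c i) * X i.castSucc : S) ^ 8
      + d4 * (∑ i : Fin 3, C (c i) * X i.castSucc) ^ 4
      + d6 * (∑ i : Fin 3, C (c i) * X i.castSucc) ^ 2
      + d7 * (∑ i : Fin 3, C (c i) * X i.castSucc) = 0 := by
  have h : dicksonPoly.eval (∑ i : Fin 3, C (c i) * X i.castSucc) = 0 := by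
    rw [dicksonPoly, Polynomial.eval_prod]
    refine Finset.prod_eq_zero (Finset.mem_univ c) ?_
    simp only [Polynomial.eval_add, Polynomial.eval_X, Polynomial.eval_C]
    exact CharTwo.add_self_eq_zero _
  rw [dicksonPoly_eq, ← d4_eq, ← d6_eq, ← d7_eq] at h
  simpa using h

/-! ### Homogeneity -/

theorem isHomogeneous_q2 : q2.IsHomogeneous 2 :=
  ((isHomogeneous_X_pow _ 2).add ((isHomogeneous_X _ _).mul (isHomogeneous_X _ _))).add
    (isHomogeneous_X_pow _ 2)

theorem isHomogeneous_c3 : c3.IsHomogeneous 3 :=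
  ((isHomogeneous_X _ _).mul (isHomogeneous_X _ _)).mul
    ((isHomogeneous_X _ _).add (isHomogeneous_X _ _))

theorem isHomogeneous_e4 : e4.IsHomogeneous 4 :=
  ((isHomogeneous_X_pow _ 4).add (isHomogeneous_q2.mul (isHomogeneous_X_pow _ 2))).add
    (isHomogeneous_c3.mul (isHomogeneous_X _ _))

theorem isHomogeneous_d4 : d4.IsHomogeneous 4 := by
  rw [d4_eq]
  exact (isHomogeneous_q2.pow 2).add isHomogeneous_e4

theorem isHomogeneous_d6 : d6.IsHomogeneous 6 := by
  rw [d6_eq]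
  exact (isHomogeneous_c3.pow 2).add (isHomogeneous_q2.mul isHomogeneous_e4)

theorem isHomogeneous_d7 : d7.IsHomogeneous 7 := by
  rw [d7_eq]
  exact isHomogeneous_c3.mul isHomogeneous_e4

theorem isHomogeneous_d8 : d8.IsHomogeneous 8 :=
  ((((isHomogeneous_X_pow _ 8).add ((isHomogeneous_X_pow _ 4).mul isHomogeneous_d4)).add
    ((isHomogeneous_X_pow _ 2).mul isHomogeneous_d6)).add
    ((isHomogeneous_X _ _).mul isHomogeneous_d7)).add (isHomogeneous_d4.pow 2)

theorem isHomogeneous_mul_of_add_eq {f g : S} {m n k : ℕ} (hf : f.IsHomogeneous m)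
    (hg : g.IsHomogeneous n) (h : m + n = k) : (f * g).IsHomogeneous k :=
  h ▸ hf.mul hg

theorem isHomogeneous_p8 : (p8 (X 0) (X 1) (X 2) : S).IsHomogeneous 8 := by
  unfold p8
  repeat' apply MvPolynomial.IsHomogeneous.add
  all_goals
    repeat' first
      | exact isHomogeneous_X _ _
      | exact isHomogeneous_X_pow _ _
      | apply isHomogeneous_mul_of_add_eq
    all_goals rfl

theorem isHomogeneous_p10 : (p10 (X 0) (X 1) (X 2) : S).IsHomogeneous 10 := by
  unfold p10
  repeat' apply MvPolynomial.IsHomogeneous.add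
  all_goals
    repeat' first
      | exact isHomogeneous_X _ _
      | exact isHomogeneous_X_pow _ _
      | apply isHomogeneous_mul_of_add_eq
    all_goals rfl

theorem isHomogeneous_a8 : a8.IsHomogeneous 8 :=
  (isHomogeneous_d7.mul (isHomogeneous_X _ _)).add isHomogeneous_p8

theorem isHomogeneous_a9 : a9.IsHomogeneous 9 := isHomogeneous_Sq isHomogeneous_a8 1

theorem isHomogeneous_a10 : a10.IsHomogeneous 10 :=
  ((((isHomogeneous_d6.mul (isHomogeneous_X_pow _ 4)).add
    (isHomogeneous_d7.mul (isHomogeneous_X_pow _ 3))).add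
    (isHomogeneous_p8.mul (isHomogeneous_X_pow _ 2))).add
    ((Sq_one_p8 ▸ isHomogeneous_Sq isHomogeneous_p8 1 :
      (p9 (X 0) (X 1) (X 2) : S).IsHomogeneous 9).mul (isHomogeneous_X _ _))).add isHomogeneous_p10

theorem isHomogeneous_a11 : a11.IsHomogeneous 11 := isHomogeneous_Sq isHomogeneous_a9 2

theorem isHomogeneous_a12 : a12.IsHomogeneous 12 := isHomogeneous_Sq isHomogeneous_a10 2

theorem isHomogeneous_a13 : a13.IsHomogeneous 13 := isHomogeneous_Sq isHomogeneous_a12 1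

/-! ### Algebraic independence -/

/-- Four elements over which `S` is algebraic form a transcendence basis, because the transcendence
degree is four. -/
theorem algebraicIndependent_of_isAlgebraic_X (v : Fin 4 → S)
    (h : ∀ i, IsAlgebraic (Algebra.adjoin (ZMod 2) (Set.range v)) (X i : S)) :
    AlgebraicIndependent (ZMod 2) v := by
  have : Algebra.IsAlgebraic (Algebra.adjoin (ZMod 2) (Set.range v)) S := by
    refine ⟨fun f => ?_⟩
    induction f using MvPolynomial.induction_on with
    | C a =>
      exact isAlgebraic_algebraMap (algebraMap (ZMod 2) (Algebra.adjoin (ZMod 2) (Set.range v)) a)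
    | add f g hf hg => exact hf.add hg
    | mul_X f i hf => exact hf.mul (h i)
  refine (Algebra.IsAlgebraic.isTranscendenceBasis_of_le_trdeg_of_finite (ZMod 2) v ?_).1
  rw [MvPolynomial.trdeg_of_isDomain]
  simp

theorem isAlgebraic_of_eight {A : Subalgebra (ZMod 2) S} {t a b c d : S} (ha : a ∈ A) (hb : b ∈ A)
    (hc : c ∈ A) (hd : d ∈ A) (h : t ^ 8 + a * t ^ 4 + b * t ^ 2 + c * t + d = 0) :
    IsAlgebraic A t := by
  refine ⟨Polynomial.X ^ 8 + Polynomial.C ⟨a, ha⟩ * Polynomial.X ^ 4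
    + Polynomial.C ⟨b, hb⟩ * Polynomial.X ^ 2 + Polynomial.C ⟨c, hc⟩ * Polynomial.X
    + Polynomial.C ⟨d, hd⟩, Polynomial.Monic.ne_zero ?_, ?_⟩
  · monicity!
  · simpa [Subalgebra.algebraMap_eq] using h

theorem X_root (i : Fin 3) :
    (X i.castSucc : S) ^ 8 + d4 * X i.castSucc ^ 4 + d6 * X i.castSucc ^ 2
      + d7 * X i.castSucc = 0 := by
  have := linearForm_root (Pi.single i 1)
  simpa [Pi.single_apply, apply_ite, ite_mul] using this

theorem algebraicIndependent_dickson : AlgebraicIndependent (ZMod 2) ![d4, d6, d7, d8] := by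
  refine algebraicIndependent_of_isAlgebraic_X _ fun i => ?_
  set A := Algebra.adjoin (ZMod 2) (Set.range ![d4, d6, d7, d8])
  have h4 : d4 ∈ A := Algebra.subset_adjoin ⟨0, rfl⟩
  have h6 : d6 ∈ A := Algebra.subset_adjoin ⟨1, rfl⟩
  have h7 : d7 ∈ A := Algebra.subset_adjoin ⟨2, rfl⟩
  have h8 : d8 ∈ A := Algebra.subset_adjoin ⟨3, rfl⟩
  induction i using Fin.lastCases with
  | last =>
    refine isAlgebraic_of_eight h4 h6 h7 (add_mem h8 (pow_mem h4 2)) ?_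
    change X 3 ^ 8 + d4 * X 3 ^ 4 + d6 * X 3 ^ 2 + d7 * X 3 + (d8 + d4 ^ 2) = 0
    rw [d8]
    grind
  | cast i =>
    refine isAlgebraic_of_eight h4 h6 h7 (zero_mem A) ?_
    rw [add_zero]
    exact X_root i

/-- The Dickson polynomial of `𝔽₂[y, z]` evaluated at `w`. -/
noncomputable def f4 : S := X 3 ^ 4 + q2 * X 3 ^ 2 + c3 * X 3

/-- Adjoining `x` makes four elements, so that the count of the transcendence degree applies. -/
theorem algebraicIndependent_q2_c3_f4 : AlgebraicIndependent (ZMod 2) ![q2, c3, f4] := by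
  have h : AlgebraicIndependent (ZMod 2) ![X 0, q2, c3, f4] := by
    refine algebraicIndependent_of_isAlgebraic_X _ fun i => ?_
    set A := Algebra.adjoin (ZMod 2) (Set.range ![(X 0 : S), q2, c3, f4])
    have h0 : (X 0 : S) ∈ A := Algebra.subset_adjoin ⟨0, rfl⟩
    have hq : q2 ∈ A := Algebra.subset_adjoin ⟨1, rfl⟩
    have hc : c3 ∈ A := Algebra.subset_adjoin ⟨2, rfl⟩
    have hf : f4 ∈ A := Algebra.subset_adjoin ⟨3, rfl⟩
    -- The equations t⁴ + `q2` t² + `c3` t = 0 (for `y`, `z`) and = `f4` (for `w`) are squared to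
    -- fit the degree-eight shape.
    have h1 := isAlgebraic_of_eight (t := X 1) (pow_mem hq 2) (pow_mem hc 2) (zero_mem A)
      (zero_mem A) (by simp only [q2, c3]; grind)
    have h2 := isAlgebraic_of_eight (t := X 2) (pow_mem hq 2) (pow_mem hc 2) (zero_mem A)
      (zero_mem A) (by simp only [q2, c3]; grind)
    have h3 := isAlgebraic_of_eight (t := X 3) (pow_mem hq 2) (pow_mem hc 2) (zero_mem A)
      (pow_mem hf 2) (by simp only [f4]; grind)
    fin_cases i
    · exact isAlgebraic_algebraMap (⟨X 0, h0⟩ : A)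
    · exact h1
    · exact h2
    · exact h3
  exact h.comp Fin.succ (Fin.succ_injective 3)

/-! ### Reduction modulo `x` -/

/-- The substitution `x ↦ 0`. -/
noncomputable def rho : S →ₐ[ZMod 2] S := lin (Matrix.diagonal ![0, 1, 1, 1])

theorem rho_X (i : Fin 4) : rho (X i) = C ((![0, 1, 1, 1] : Fin 4 → ZMod 2) i) * X i := by
  simp [rho, lin_X, Matrix.diagonal_apply, apply_ite, ite_mul]

theorem rho_X_zero : rho (X 0) = 0 := by simp [rho_X]
theorem rho_X_one : rho (X 1) = X 1 := by simp [rho_X]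
theorem rho_X_two : rho (X 2) = X 2 := by simp [rho_X]
theorem rho_X_three : rho (X 3) = X 3 := by simp [rho_X]

theorem rho_q2 : rho q2 = q2 := by simp [q2, rho_X_one, rho_X_two]
theorem rho_c3 : rho c3 = c3 := by simp [c3, rho_X_one, rho_X_two]
theorem rho_e4 : rho e4 = 0 := by simp [e4, rho_X_zero]
theorem rho_d4 : rho d4 = q2 ^ 2 := by simp [d4_eq, rho_q2, rho_e4]
theorem rho_d6 : rho d6 = c3 ^ 2 := by simp [d6_eq, rho_c3, rho_e4]
theorem rho_d7 : rho d7 = 0 := by simp [d7_eq, rho_e4]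

/-- Modulo `x` the Dickson polynomial is the square of that of `y, z`. Adding `d4 ^ 2` leaves its
value at `w`, so `d8 + d4 ^ 2` is the convenient fourth parameter. -/
theorem rho_d8_add : rho (d8 + d4 ^ 2) = f4 ^ 2 := by
  simp only [d8, map_add, map_mul, map_pow, rho_d4, rho_d6, rho_d7, rho_X_three, f4]
  grind

theorem rho_a8 : rho a8 = q2 * c3 ^ 2 := by
  rw [a8, map_add, map_mul, rho_d7, map_p8, rho_X_zero, rho_X_one, rho_X_two, p8, q2, c3]
  grind

theorem rho_Sq (k : ℕ) (f : S) : rho (Sq k f) = Sq k (rho f) := (Sq_lin _ _ _).symm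

theorem rho_a9 : rho a9 = c3 ^ 3 := by
  rw [a9, rho_Sq, rho_a8, Sq_one_mul, Sq_one_sq, Sq_one_q2]
  ring

theorem rho_a11 : rho a11 = q2 * c3 ^ 3 := by
  rw [a11, rho_Sq, rho_a9, pow_succ, Sq_two_mul, Sq_two_sq, Sq_one_sq, Sq_one_c3, Sq_two_c3]
  ring

theorem rho_a10 : rho a10 = c3 ^ 2 * f4 := by
  have h9 : p9 0 (X 1) (X 2) = c3 ^ 3 := by
    simp only [p9, c3]
    grind
  have h := rho_a8
  simp only [a8, map_add, map_mul, rho_d7, map_p8, rho_X_zero, rho_X_one, rho_X_two, zero_mul,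
    zero_add] at h
  have h9' : rho (p9 (X 0) (X 1) (X 2)) = c3 ^ 3 := by
    rw [← h9]
    simp [p9, rho_X_zero, rho_X_one, rho_X_two]
  simp only [a10, map_add, map_mul, map_pow, rho_d7, rho_d6, map_p8, rho_X_zero, rho_X_one,
    rho_X_two, rho_X_three, h, h9', map_p10, f4]
  rw [p10]
  grind

theorem Sq_one_f4 : Sq 1 f4 = 0 := by
  simp only [f4, Sq_add, Sq_one_mul, Sq_one_X, Sq_one_q2, Sq_one_c3, Sq_one_sq, Sq_one_four]
  grind

theorem Sq_two_f4 : Sq 2 f4 = q2 * f4 := by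
  simp only [f4, Sq_add, Sq_two_mul, Sq_one_X, Sq_one_q2, Sq_one_c3, Sq_one_sq, Sq_two_four,
    Sq_two_X, Sq_two_q2, Sq_two_c3, Sq_two_sq]
  grind

theorem rho_a12 : rho a12 = q2 * c3 ^ 2 * f4 := by
  rw [a12, rho_Sq, rho_a10, Sq_two_mul, Sq_two_sq, Sq_one_sq, Sq_one_c3, Sq_two_f4]
  ring

theorem rho_a13 : rho a13 = c3 ^ 3 * f4 := by
  rw [a13, rho_Sq, rho_a12, Sq_one_mul, Sq_one_mul, Sq_one_sq, Sq_one_f4, Sq_one_q2]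
  ring

theorem rho_eq_zero_of_dvd {f : S} (h : d7 ∣ f) : rho f = 0 := by
  obtain ⟨g, rfl⟩ := h
  rw [map_mul, rho_d7, zero_mul]

/-! ### Coefficients in `R` modulo `d7` -/

theorem d4_mem_R : d4 ∈ R := Algebra.subset_adjoin (by simp)
theorem d6_mem_R : d6 ∈ R := Algebra.subset_adjoin (by simp)
theorem d7_mem_R : d7 ∈ R := Algebra.subset_adjoin (by simp)
theorem d8_mem_R : d8 ∈ R := Algebra.subset_adjoin (by simp)

/-- Elements of `R` are polynomials in `d₄, d₆, d₈ + d₄²` modulo `d₇`. -/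
theorem exists_eq_aeval_add_of_mem_R {r : S} (hr : r ∈ R) :
    ∃ P : MvPolynomial (Fin 3) (ZMod 2), ∃ s ∈ R, r = aeval ![d4, d6, d8 + d4 ^ 2] P + d7 * s := by
  have hP : ∀ P : MvPolynomial (Fin 3) (ZMod 2), aeval ![d4, d6, d8 + d4 ^ 2] P ∈ R := by
    intro P
    induction P using MvPolynomial.induction_on with
    | C a => rw [algHom_C]; exact R.algebraMap_mem a
    | add p q hp hq => rw [map_add]; exact add_mem hp hq
    | mul_X p i hp =>
      rw [map_mul, aeval_X]
      refine mul_mem hp ?_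
      fin_cases i
      exacts [d4_mem_R, d6_mem_R, add_mem d8_mem_R (pow_mem d4_mem_R 2)]
  induction hr using Algebra.adjoin_induction with
  | mem r hr =>
    rcases hr with rfl | rfl | rfl | rfl
    · exact ⟨X 0, 0, zero_mem R, by simp⟩
    · exact ⟨X 1, 0, zero_mem R, by simp⟩
    · exact ⟨0, 1, one_mem R, by simp⟩
    · refine ⟨X 2 + X 0 ^ 2, 0, zero_mem R, ?_⟩
      simp only [map_add, map_pow, aeval_X, Matrix.cons_val]
      grind
  | algebraMap a => exact ⟨C a, 0, zero_mem R, by simp⟩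
  | add r s hr hs ihr ihs =>
    obtain ⟨P, r', hr', hP'⟩ := ihr
    obtain ⟨Q, s', hs', hQ'⟩ := ihs
    refine ⟨P + Q, r' + s', add_mem hr' hs', ?_⟩
    rw [hP', hQ', map_add]
    ring
  | mul r s hr hs ihr ihs =>
    obtain ⟨P, r', hr', hP'⟩ := ihr
    obtain ⟨Q, s', hs', hQ'⟩ := ihs
    refine ⟨P * Q, r' * s + aeval ![d4, d6, d8 + d4 ^ 2] P * s',
      add_mem (mul_mem hr' hs) (mul_mem (hP P) hs'), ?_⟩
    rw [hP', hQ', map_mul]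
    ring

/-- Monomials that are pairwise incongruent modulo `2` are independent over the subring of
squares. -/
theorem eq_zero_of_sum_expand_eq_zero {ι σ : Type*} [Fintype ι] (e : ι → σ →₀ ℕ)
    (he : ∀ i j, (∀ k, e i k % 2 = e j k % 2) → i = j) (P : ι → MvPolynomial σ (ZMod 2))
    (h : ∑ i, expand 2 (P i) * monomial (e i) 1 = 0) (i : ι) : P i = 0 := by
  classical
  ext n
  -- This exponent has the parity of `e i`, so only the `i`-th summand contributes, with the
  -- coefficient of `P i` at `n`.
  have hc := congrArg (coeff (2 • n + e i)) h
  rw [coeff_sum, Finset.sum_eq_single i] at hc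
  · rw [coeff_mul_monomial, mul_one, coeff_expand_smul _ two_ne_zero] at hc
    simpa using hc
  · intro j _ hj
    rw [coeff_mul_monomial', mul_one]
    split_ifs with hle
    · have : ¬ ∀ k, e i k % 2 = e j k % 2 := fun hk => hj (he i j hk).symm
      push Not at this
      obtain ⟨k, hk⟩ := this
      refine coeff_expand_of_not_dvd _ (i := k) ?_
      have := hle k
      simp only [Finsupp.coe_tsub, Finsupp.coe_add, Finsupp.coe_smul, Pi.sub_apply, Pi.add_apply,
        Pi.smul_apply, smul_eq_mul] at this ⊢
      omega
    · rfl
  · simp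

/-- Modulo `d7`, coefficients are polynomials in `d4`, `d6`, `d8 + d4 ^ 2`, which reduce to the
squares of `q2`, `c3`, `f4`. Monomials of distinct parity are independent over these squares. -/
theorem exists_eq_d7_mul_of_rho_sum_eq_zero {ι : Type*} [Fintype ι] (e : ι → Fin 3 →₀ ℕ)
    (he : ∀ i j, (∀ k, e i k % 2 = e j k % 2) → i = j) (b : ι → S)
    (hb : ∀ i, rho (b i) = aeval ![q2, c3, f4] (monomial (e i) (1 : ZMod 2)))
    (r : ι → S) (hr : ∀ i, r i ∈ R) (h : rho (∑ i, r i * b i) = 0) (i : ι) :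
    ∃ s ∈ R, r i = d7 * s := by
  choose P s hs hP using fun i => exists_eq_aeval_add_of_mem_R (hr i)
  have hrho : ∀ i, rho (r i) = aeval ![q2, c3, f4] (expand 2 (P i)) := by
    intro i
    rw [hP i, map_add, rho_eq_zero_of_dvd (dvd_mul_right _ _), add_zero, aeval_expand,
      ← AlgHom.comp_apply]
    congr 1
    ext1 k
    rw [AlgHom.comp_apply, aeval_X, aeval_X]
    fin_cases k
    exacts [rho_d4, rho_d6, rho_d8_add]
  have h0 : ∑ i, expand 2 (P i) * monomial (e i) 1 = 0 := by
    apply algebraicIndependent_q2_c3_f4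
    rw [map_zero, ← h]
    simp [hb, hrho]
  refine ⟨s i, hs i, ?_⟩
  rw [hP i, eq_zero_of_sum_expand_eq_zero e he P h0 i, map_zero, zero_add]

/-! ### The group `GL₃(𝔽₂)` -/

/-- The block diagonal matrix with blocks `v` and `1`. -/
def blk (v : Matrix (Fin 3) (Fin 3) (ZMod 2)) : Matrix (Fin 4) (Fin 4) (ZMod 2) :=
  !![v 0 0, v 0 1, v 0 2, 0; v 1 0, v 1 1, v 1 2, 0; v 2 0, v 2 1, v 2 2, 0; 0, 0, 0, 1]

theorem blk_mul (v w : Matrix (Fin 3) (Fin 3) (ZMod 2)) : blk (v * w) = blk v * blk w := by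
  ext i j
  fin_cases i <;> fin_cases j <;>
    simp [blk, Matrix.mul_apply, Fin.sum_univ_three, Fin.sum_univ_four]

theorem blk_one : blk 1 = 1 := by
  ext i j
  fin_cases i <;> fin_cases j <;> simp [blk]

/-- The upper left block of `matA`. -/
def blockA : Matrix (Fin 3) (Fin 3) (ZMod 2) := !![1, 1, 1; 1, 0, 1; 1, 1, 0]

/-- The upper left block of `matB`. -/
def blockB : Matrix (Fin 3) (Fin 3) (ZMod 2) := !![0, 0, 1; 0, 1, 0; 1, 1, 1]

theorem transvection_mem_closure (i j : Fin 3) (hij : i ≠ j) :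
    Matrix.transvection i j (1 : ZMod 2) ∈ Submonoid.closure {blockA, blockB} := by
  have hA : blockA ∈ Submonoid.closure {blockA, blockB} := Submonoid.subset_closure (by simp)
  have hB : blockB ∈ Submonoid.closure {blockA, blockB} := Submonoid.subset_closure (by simp)
  have key : ∀ l : List Bool, (l.map fun b => if b then blockA else blockB).prod ∈
      Submonoid.closure {blockA, blockB} := by
    intro l
    refine Submonoid.list_prod_mem _ fun x hx => ?_
    obtain ⟨b, -, rfl⟩ := List.mem_map.mp hx
    cases b
    exacts [hB, hA]
  -- Explicit words in the two generators, with `true` standing for `blockA`.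
  have h : ∃ l : List Bool,
      Matrix.transvection i j (1 : ZMod 2) =
        (l.map fun b => if b then blockA else blockB).prod := by
    fin_cases i <;> fin_cases j
    · exact absurd rfl hij
    · exact ⟨[true, false, true, true, false, true], by decide⟩
    · exact ⟨[false, false, true, false, true, false, false], by decide⟩
    · exact ⟨[true, true, true, false, true, false, true, true], by decide⟩
    · exact absurd rfl hij
    · exact ⟨[true, true, false, false, true, true, false, true, false], by decide⟩
    · exact ⟨[true, false, true, false], by decide⟩
    · exact ⟨[true, true, true, false, true, true, false, false, true], by decide⟩
    · exact absurd rfl hij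
  obtain ⟨l, hl⟩ := h
  exact hl ▸ key l

/-- Gaussian elimination: over 𝔽₂ the invertible diagonal factor is trivial, and each transvection
has coefficient 0 or 1. -/
theorem mem_closure_of_det_ne_zero (v : Matrix (Fin 3) (Fin 3) (ZMod 2)) (hv : v.det ≠ 0) :
    v ∈ Submonoid.closure {blockA, blockB} := by
  have htv : ∀ L : List (Matrix.TransvectionStruct (Fin 3) (ZMod 2)),
      (L.map Matrix.TransvectionStruct.toMatrix).prod ∈ Submonoid.closure {blockA, blockB} := by
    intro L
    refine Submonoid.list_prod_mem _ fun x hx => ?_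
    obtain ⟨t, -, rfl⟩ := List.mem_map.mp hx
    obtain h | h : t.c = 0 ∨ t.c = 1 := by
      generalize t.c = c
      revert c
      decide
    · rw [Matrix.TransvectionStruct.toMatrix, h, Matrix.transvection_zero]
      exact one_mem _
    · rw [Matrix.TransvectionStruct.toMatrix, h]
      exact transvection_mem_closure _ _ t.hij
  obtain ⟨L, L', D, rfl⟩ := Matrix.Pivot.exists_list_transvec_mul_diagonal_mul_list_transvec v
  have hD : D = 1 := by
    funext i
    have h : D i ≠ 0 := fun h0 => hv (by
      rw [Matrix.det_mul, Matrix.det_mul, Matrix.det_diagonal,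
        Finset.prod_eq_zero (Finset.mem_univ i) h0, mul_zero, zero_mul])
    rw [Pi.one_apply]
    revert h
    generalize D i = c
    revert c
    decide
  rw [hD, show Matrix.diagonal (1 : Fin 3 → ZMod 2) = 1 from Matrix.diagonal_one, mul_one]
  exact mul_mem (htv L) (htv L')

theorem lin_blk_eq_self {F : S} (hA : lin (blk blockA) F = F) (hB : lin (blk blockB) F = F)
    (v : Matrix (Fin 3) (Fin 3) (ZMod 2)) (hv : v.det ≠ 0) : lin (blk v) F = F := by
  have := mem_closure_of_det_ne_zero v hv
  induction this using Submonoid.closure_induction with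
  | mem x hx =>
    rcases hx with rfl | rfl
    exacts [hA, hB]
  | one => rw [blk_one, lin_one]
  | mul x y hx hy ihx ihy =>
    rw [Matrix.det_mul] at hv
    rw [blk_mul, lin_mul, ihx (left_ne_zero_of_mul hv), ihy (right_ne_zero_of_mul hv)]

/-! ### Invariants of `GL₃(𝔽₂)` up to powers of `d₇` -/

/-- The linear form with coefficients `c` in `x, y, z`. -/
noncomputable def linForm (c : Fin 3 → ZMod 2) : S := ∑ i : Fin 3, C (c i) * X i.castSucc

theorem lin_blk_X_castSucc (v : Matrix (Fin 3) (Fin 3) (ZMod 2)) (i : Fin 3) :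
    lin (blk v) (X i.castSucc) = linForm (v i) := by
  rw [lin_X, Fin.sum_univ_castSucc, linForm]
  fin_cases i <;> simp [blk, Fin.sum_univ_three]

theorem lin_blk_X_three (v : Matrix (Fin 3) (Fin 3) (ZMod 2)) : lin (blk v) (X 3) = X 3 := by
  simp [lin_X, blk, Fin.sum_univ_four]

/-- The power sums of the linear forms in `x, y, z`. -/
noncomputable def psum (k : ℕ) : S := ∑ c : Fin 3 → ZMod 2, linForm c ^ k

/-- Each linear form is a root of the Dickson polynomial; multiply its equation by the `k`-th power
and sum. -/
theorem psum_add_eight (k : ℕ) :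
    psum (k + 8) = d4 * psum (k + 4) + d6 * psum (k + 2) + d7 * psum (k + 1) := by
  simp only [psum, Finset.mul_sum, ← Finset.sum_add_distrib]
  refine Finset.sum_congr rfl fun c _ => ?_
  have h := linearForm_root c
  rw [← linForm] at h
  have h2 : (2 : S) = 0 := CharTwo.two_eq_zero
  linear_combination linForm c ^ k * h - linForm c ^ k *
    (d4 * linForm c ^ 4 + d6 * linForm c ^ 2 + d7 * linForm c) * h2

theorem psum_explicit (k : ℕ) :
    psum k = 0 ^ k + X 2 ^ k + X 1 ^ k + (X 1 + X 2) ^ k + X 0 ^ k + (X 0 + X 2) ^ k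
      + (X 0 + X 1) ^ k + (X 0 + X 1 + X 2) ^ k := by
  rw [psum, univ_eq]
  rw [Finset.sum_insert (by decide), Finset.sum_insert (by decide), Finset.sum_insert (by decide),
    Finset.sum_insert (by decide), Finset.sum_insert (by decide), Finset.sum_insert (by decide),
    Finset.sum_insert (by decide), Finset.sum_singleton]
  simp [linForm, Fin.sum_univ_three, add_assoc]

theorem psum_eq_zero {k : ℕ} (hk : k < 7) : psum k = 0 := by
  rw [psum_explicit]
  interval_cases k <;> grind

theorem psum_seven : psum 7 = d7 := by
  rw [psum_explicit, d7_eq, e4, c3, q2]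
  grind

theorem psum_eight : psum 8 = 0 := by
  rw [psum_add_eight 0, psum_eq_zero, psum_eq_zero, psum_eq_zero] <;> norm_num

theorem psum_nine : psum 9 = 0 := by
  rw [psum_add_eight 1, psum_eq_zero, psum_eq_zero, psum_eq_zero] <;> norm_num

theorem psum_ten : psum 10 = 0 := by
  rw [psum_add_eight 2, psum_eq_zero, psum_eq_zero, psum_eq_zero] <;> norm_num

theorem psum_mem {A : Subalgebra (ZMod 2) S} (h4 : d4 ∈ A) (h6 : d6 ∈ A) (h7 : d7 ∈ A) (k : ℕ) :
    psum k ∈ A := by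
  induction k using Nat.strong_induction_on with
  | _ k ih =>
    rcases lt_trichotomy k 7 with hk | rfl | hk
    · rw [psum_eq_zero hk]; exact zero_mem A
    · rw [psum_seven]; exact h7
    · obtain ⟨k, rfl⟩ := Nat.exists_eq_add_of_le' (show 8 ≤ k from hk)
      rw [psum_add_eight]
      exact add_mem (add_mem (mul_mem h4 (ih _ (by omega))) (mul_mem h6 (ih _ (by omega))))
        (mul_mem h7 (ih _ (by omega)))

/-- The Moore matrix of the linear forms with coefficients the rows of `v`. -/
noncomputable def moore (v : Matrix (Fin 3) (Fin 3) (ZMod 2)) : Matrix (Fin 3) (Fin 3) S :=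
  Matrix.of fun j i => linForm (v i) ^ 2 ^ (j : ℕ)

/-- By additivity of Frobenius the Moore matrix is that of `x, y, z` times the transpose of `v`.
Thus a sum over all matrices weighted by Moore determinants only sees the invertible ones. -/
theorem det_moore_eq_zero {v : Matrix (Fin 3) (Fin 3) (ZMod 2)} (hv : v.det = 0) :
    (moore v).det = 0 := by
  have h : moore v = moore 1 * (v.map C).transpose := by
    ext1 j i
    simp only [moore, Matrix.of_apply, Matrix.mul_apply, Matrix.transpose_apply, Matrix.map_apply]
    rw [linForm, sum_pow_char_pow]
    refine Finset.sum_congr rfl fun k _ => ?_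
    have hC : (C (v i k) : S) ^ 2 ^ (j : ℕ) = C (v i k) := by
      rw [← map_pow, ZMod.pow_card_pow]
    have hX : linForm ((1 : Matrix (Fin 3) (Fin 3) (ZMod 2)) k) = X k.castSucc := by
      simp [linForm, Matrix.one_apply, apply_ite, ite_mul]
    rw [mul_pow, hC, hX, mul_comm]
  rw [h, Matrix.det_mul, Matrix.det_transpose, ← RingHom.mapMatrix_apply, ← RingHom.map_det,
    hv, map_zero, mul_zero]

/-- The sum of the images of `F` under all linear substitutions of `x, y, z`, weighted by the
Moore determinants. -/
noncomputable def transfer : S →ₗ[ZMod 2] S :=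
  ∑ v : Matrix (Fin 3) (Fin 3) (ZMod 2),
    LinearMap.mulLeft (ZMod 2) (moore v).det ∘ₗ (lin (blk v)).toLinearMap

theorem transfer_apply (F : S) :
    transfer F = ∑ v : Matrix (Fin 3) (Fin 3) (ZMod 2), (moore v).det * lin (blk v) F := by
  simp [transfer]

theorem transfer_mul {F : S}
    (hF : ∀ v : Matrix (Fin 3) (Fin 3) (ZMod 2), v.det ≠ 0 → lin (blk v) F = F) (h : S) :
    transfer (F * h) = F * transfer h := by
  rw [transfer_apply, transfer_apply, Finset.mul_sum]
  refine Finset.sum_congr rfl fun v _ => ?_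
  by_cases hv : v.det = 0
  · rw [det_moore_eq_zero hv]
    ring
  · rw [map_mul, hF v hv]
    ring

/-- Because `v` runs over all matrices, its rows vary independently. In each term of the expanded
determinant the sum therefore splits into a product of power sums. -/
theorem transfer_monomial (a : Fin 3 → ℕ) (b : ℕ) :
    transfer ((∏ i : Fin 3, (X i.castSucc : S) ^ a i) * X 3 ^ b) =
      (Matrix.of fun j i : Fin 3 => psum (2 ^ (j : ℕ) + a i)).det * X 3 ^ b := by
  have key : ∀ σ : Equiv.Perm (Fin 3),
      ∏ i, psum (2 ^ (σ i : ℕ) + a i) = ∑ v : Matrix (Fin 3) (Fin 3) (ZMod 2),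
        (∏ i, linForm (v i) ^ 2 ^ (σ i : ℕ)) * ∏ i, linForm (v i) ^ a i := by
    intro σ
    simp only [psum]
    rw [Finset.prod_univ_sum, Fintype.piFinset_univ]
    refine Finset.sum_congr rfl fun v _ => ?_
    rw [← Finset.prod_mul_distrib]
    exact Finset.prod_congr rfl fun i _ => pow_add _ _ _
  rw [transfer_apply]
  simp only [map_mul, map_prod, map_pow, lin_blk_X_castSucc, lin_blk_X_three, ← mul_assoc]
  rw [← Finset.sum_mul]
  refine congrArg (· * X 3 ^ b) ?_
  simp only [Matrix.det_apply, moore, Matrix.of_apply, key, Finset.sum_mul, Finset.smul_sum,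
    smul_mul_assoc]
  rw [Finset.sum_comm]

theorem transfer_mem {A : Subalgebra (ZMod 2) S} (h4 : d4 ∈ A) (h6 : d6 ∈ A) (h7 : d7 ∈ A)
    (hw : X 3 ∈ A) (F : S) : transfer F ∈ A := by
  rw [F.as_sum, map_sum]
  refine sum_mem fun e _ => ?_
  rw [monomial_eq, Finsupp.prod_fintype _ _ (by simp), Fin.prod_univ_castSucc, ← algebraMap_eq,
    ← Algebra.smul_def, map_smul]
  refine A.smul_mem ?_ _
  rw [show Fin.last 3 = (3 : Fin 4) from rfl, transfer_monomial (fun i => e i.castSucc),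
    Matrix.det_apply]
  refine mul_mem ?_ (pow_mem hw _)
  exact sum_mem fun σ _ => zsmul_mem (prod_mem fun i _ => psum_mem h4 h6 h7 _) _

/-- The exponents are 7 − 1, 7 − 2, 7 − 4: the matrix of power sums then has `psum 7 = d7` on the
diagonal and zeros elsewhere. -/
theorem transfer_ref : transfer (X 0 ^ 6 * X 1 ^ 5 * X 2 ^ 3) = d7 ^ 3 := by
  have h : (X 0 ^ 6 * X 1 ^ 5 * X 2 ^ 3 : S) =
      (∏ i : Fin 3, (X i.castSucc : S) ^ (![6, 5, 3] : Fin 3 → ℕ) i) * X 3 ^ 0 := by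
    rw [Fin.prod_univ_three, pow_zero, mul_one]
    rfl
  rw [h, transfer_monomial, Matrix.det_fin_three]
  simp only [Matrix.of_apply, Fin.isValue, Fin.coe_ofNat_eq_mod, Matrix.cons_val, Nat.reduceMod,
    Nat.reducePow, Nat.reduceAdd, pow_zero, psum_seven, psum_eight, psum_nine, psum_ten,
    psum_eq_zero (show 4 < 7 by norm_num), psum_eq_zero (show 5 < 7 by norm_num),
    psum_eq_zero (show 6 < 7 by norm_num)]
  ring

/-- The transfer is linear over the invariants, so `d7 ^ 3 * F` is the transfer of `F` times the
reference monomial. A general `A` lets the result be pulled back along `dropW` and `substA8`. -/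
theorem d7_pow_three_mul_mem {A : Subalgebra (ZMod 2) S} (h4 : d4 ∈ A) (h6 : d6 ∈ A)
    (h7 : d7 ∈ A) (hw : X 3 ∈ A) {F : S} (hA : lin (blk blockA) F = F)
    (hB : lin (blk blockB) F = F) : d7 ^ 3 * F ∈ A := by
  have h := transfer_mul (lin_blk_eq_self hA hB) (X 0 ^ 6 * X 1 ^ 5 * X 2 ^ 3)
  rw [transfer_ref] at h
  rw [mul_comm, ← h]
  exact transfer_mem h4 h6 h7 hw _

/-! ### Invariance -/

theorem mem_invariantRing_L32 {f : S} :
    f ∈ invariantRing L32 ↔ lin matA.val f = f ∧ lin matB.val f = f := by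
  simp only [invariantRing, Algebra.mem_iInf, AlgHom.mem_equalizer, AlgHom.id_apply]
  constructor
  · intro h
    exact ⟨h matA (Subgroup.subset_closure (by simp)), h matB (Subgroup.subset_closure (by simp))⟩
  · rintro ⟨hA, hB⟩ g hg
    induction hg using Subgroup.closure_induction with
    | mem x hx =>
      rcases hx with rfl | rfl
      exacts [hA, hB]
    | one => exact lin_one f
    | mul x y hx hy ihx ihy =>
      rw [substHom_eq_lin] at *
      rw [Units.val_mul, lin_mul, ihx, ihy]
    | inv x hx ihx =>
      rw [substHom_eq_lin] at *
      conv_lhs => rw [← ihx]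
      rw [← lin_mul, ← Units.val_mul, mul_inv_cancel, Units.val_one, lin_one]

theorem lin_matA_X : lin matA.val (X 0) = X 0 + X 1 + X 2 ∧ lin matA.val (X 1) = X 0 + X 2 ∧
    lin matA.val (X 2) = X 0 + X 1 ∧ lin matA.val (X 3) = X 0 + X 1 + X 3 := by
  simp [lin_X, matA, Fin.sum_univ_four]

theorem lin_matB_X : lin matB.val (X 0) = X 2 ∧ lin matB.val (X 1) = X 1 ∧
    lin matB.val (X 2) = X 0 + X 1 + X 2 ∧ lin matB.val (X 3) = X 0 + X 1 + X 3 := by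
  simp [lin_X, matB, Fin.sum_univ_four]

theorem d4_mem_invariantRing : d4 ∈ invariantRing L32 := by
  obtain ⟨hA0, hA1, hA2, -⟩ := lin_matA_X
  obtain ⟨hB0, hB1, hB2, -⟩ := lin_matB_X
  rw [mem_invariantRing_L32, d4_eq, e4, c3, q2]
  constructor
  · simp only [map_add, map_mul, map_pow, hA0, hA1, hA2]
    grind
  · simp only [map_add, map_mul, map_pow, hB0, hB1, hB2]
    grind

theorem d6_mem_invariantRing : d6 ∈ invariantRing L32 := by
  obtain ⟨hA0, hA1, hA2, -⟩ := lin_matA_X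
  obtain ⟨hB0, hB1, hB2, -⟩ := lin_matB_X
  rw [mem_invariantRing_L32, d6_eq, e4, c3, q2]
  constructor
  · simp only [map_add, map_mul, map_pow, hA0, hA1, hA2]
    grind
  · simp only [map_add, map_mul, map_pow, hB0, hB1, hB2]
    grind

theorem d7_mem_invariantRing : d7 ∈ invariantRing L32 := by
  obtain ⟨hA0, hA1, hA2, -⟩ := lin_matA_X
  obtain ⟨hB0, hB1, hB2, -⟩ := lin_matB_X
  rw [mem_invariantRing_L32, d7_eq, e4, c3, q2]
  constructor
  · simp only [map_add, map_mul, map_pow, hA0, hA1, hA2]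
    grind
  · simp only [map_add, map_mul, map_pow, hB0, hB1, hB2]
    grind

theorem d8_mem_invariantRing : d8 ∈ invariantRing L32 := by
  obtain ⟨hA4, hB4⟩ := mem_invariantRing_L32.mp d4_mem_invariantRing
  obtain ⟨hA6, hB6⟩ := mem_invariantRing_L32.mp d6_mem_invariantRing
  obtain ⟨hA7, hB7⟩ := mem_invariantRing_L32.mp d7_mem_invariantRing
  -- Both generators send `w` to `w + (x + y)`. The Dickson polynomial is additive in characteristic
  -- two and vanishes at `x + y`.
  have h := linearForm_root ![1, 1, 0]
  simp only [Fin.sum_univ_three, Matrix.cons_val, map_one, map_zero, one_mul, zero_mul,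
    add_zero] at h
  change (X 0 + X 1 : S) ^ 8 + d4 * (X 0 + X 1) ^ 4 + d6 * (X 0 + X 1) ^ 2 + d7 * (X 0 + X 1) = 0
    at h
  have key : ((X 0 + X 1 + X 3) ^ 8 + (X 0 + X 1 + X 3) ^ 4 * d4 + (X 0 + X 1 + X 3) ^ 2 * d6
      + (X 0 + X 1 + X 3) * d7 + d4 ^ 2 : S) = d8 := by
    rw [d8]
    generalize (X 0 + X 1 : S) = t at *
    grind
  rw [mem_invariantRing_L32]
  constructor
  · conv_lhs => rw [d8]
    simp only [map_add, map_mul, map_pow, hA4, hA6, hA7, lin_matA_X.2.2.2, key]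
  · conv_lhs => rw [d8]
    simp only [map_add, map_mul, map_pow, hB4, hB6, hB7, lin_matB_X.2.2.2, key]

theorem R_le_invariantRing : R ≤ invariantRing L32 := by
  refine Algebra.adjoin_le ?_
  rintro r (rfl | rfl | rfl | rfl)
  exacts [d4_mem_invariantRing, d6_mem_invariantRing, d7_mem_invariantRing, d8_mem_invariantRing]

theorem a8_mem_invariantRing : a8 ∈ invariantRing L32 := by
  obtain ⟨hA7, hB7⟩ := mem_invariantRing_L32.mp d7_mem_invariantRing
  rw [mem_invariantRing_L32, a8, map_add, map_mul, map_p8, hA7, map_add, map_mul, map_p8, hB7,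
    lin_matA_X.1, lin_matA_X.2.1, lin_matA_X.2.2.1, lin_matA_X.2.2.2,
    lin_matB_X.1, lin_matB_X.2.1, lin_matB_X.2.2.1, lin_matB_X.2.2.2]
  constructor
  · simp only [d7_eq, e4, c3, q2, p8]
    grind
  · simp only [d7_eq, e4, c3, q2, p8]
    grind

theorem Sq_mem_invariantRing {f : S} (hf : f ∈ invariantRing L32) (k : ℕ) :
    Sq k f ∈ invariantRing L32 := by
  rw [mem_invariantRing_L32] at *
  rw [← Sq_lin, ← Sq_lin, hf.1, hf.2]
  exact ⟨rfl, rfl⟩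

theorem d7_ne_zero : d7 ≠ 0 := by
  have := algebraicIndependent_dickson.ne_zero 2
  simpa using this

theorem mem_invariantRing_of_d7_mul_mem {f : S} (hf : d7 * f ∈ invariantRing L32) :
    f ∈ invariantRing L32 := by
  obtain ⟨hA7, hB7⟩ := mem_invariantRing_L32.mp d7_mem_invariantRing
  rw [mem_invariantRing_L32, map_mul, map_mul, hA7, hB7] at hf
  rw [mem_invariantRing_L32]
  exact ⟨mul_left_cancel₀ d7_ne_zero hf.1, mul_left_cancel₀ d7_ne_zero hf.2⟩

theorem a9_mem_invariantRing : a9 ∈ invariantRing L32 := Sq_mem_invariantRing a8_mem_invariantRing 1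

theorem a11_mem_invariantRing : a11 ∈ invariantRing L32 :=
  Sq_mem_invariantRing a9_mem_invariantRing 2

theorem a10_mem_invariantRing : a10 ∈ invariantRing L32 := by
  refine mem_invariantRing_of_d7_mul_mem ?_
  rw [d7_mul_a10]
  exact add_mem (mul_mem a8_mem_invariantRing a9_mem_invariantRing)
    (mul_mem d6_mem_invariantRing a11_mem_invariantRing)

theorem a12_mem_invariantRing : a12 ∈ invariantRing L32 :=
  Sq_mem_invariantRing a10_mem_invariantRing 2

theorem a13_mem_invariantRing : a13 ∈ invariantRing L32 :=
  Sq_mem_invariantRing a12_mem_invariantRing 1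

/-! ### Invariants not involving `w` -/

/-- The substitution `w ↦ 0`. -/
noncomputable def dropW : S →ₐ[ZMod 2] S := lin (Matrix.diagonal ![1, 1, 1, 0])

theorem dropW_X (i : Fin 4) : dropW (X i) = C ((![1, 1, 1, 0] : Fin 4 → ZMod 2) i) * X i := by
  simp [dropW, lin_X, Matrix.diagonal_apply, apply_ite, ite_mul]

theorem dropW_X_zero : dropW (X 0) = X 0 := by simp [dropW_X]
theorem dropW_X_one : dropW (X 1) = X 1 := by simp [dropW_X]
theorem dropW_X_two : dropW (X 2) = X 2 := by simp [dropW_X]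
theorem dropW_X_three : dropW (X 3) = 0 := by simp [dropW_X]
theorem dropW_q2 : dropW q2 = q2 := by simp [q2, dropW_X_one, dropW_X_two]
theorem dropW_c3 : dropW c3 = c3 := by simp [c3, dropW_X_one, dropW_X_two]
theorem dropW_e4 : dropW e4 = e4 := by simp [e4, dropW_q2, dropW_c3, dropW_X_zero]
theorem dropW_d4 : dropW d4 = d4 := by simp [d4_eq, dropW_q2, dropW_e4]
theorem dropW_d6 : dropW d6 = d6 := by simp [d6_eq, dropW_q2, dropW_c3, dropW_e4]
theorem dropW_d7 : dropW d7 = d7 := by simp [d7_eq, dropW_c3, dropW_e4]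

theorem dropW_Sq (k : ℕ) (f : S) : dropW (Sq k f) = Sq k (dropW f) := (Sq_lin _ _ _).symm

theorem dropW_p8 : dropW (p8 (X 0) (X 1) (X 2)) = p8 (X 0) (X 1) (X 2) := by
  rw [map_p8, dropW_X_zero, dropW_X_one, dropW_X_two]

theorem dropW_p9 : dropW (p9 (X 0) (X 1) (X 2)) = p9 (X 0) (X 1) (X 2) := by
  rw [← Sq_one_p8, dropW_Sq, dropW_p8]

theorem dropW_p11 : dropW (p11 (X 0) (X 1) (X 2)) = p11 (X 0) (X 1) (X 2) := by
  rw [← Sq_two_p9, dropW_Sq, dropW_p9]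

/-- The invariants in `𝔽₂[x, y, z]`. -/
noncomputable def invXYZ : Subalgebra (ZMod 2) S :=
  invariantRing L32 ⊓ AlgHom.equalizer dropW (AlgHom.id (ZMod 2) S)

theorem mem_invXYZ {f : S} : f ∈ invXYZ ↔ f ∈ invariantRing L32 ∧ dropW f = f := Iff.rfl

theorem Sq_mem_invXYZ {f : S} (hf : f ∈ invXYZ) (k : ℕ) : Sq k f ∈ invXYZ :=
  ⟨Sq_mem_invariantRing hf.1 k, by
    change dropW (Sq k f) = Sq k f
    rw [dropW_Sq, (mem_invXYZ.mp hf).2]⟩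

/-- The elements of `S` that a power of `d₇` multiplies into `R`. -/
noncomputable def Rsat : Subalgebra (ZMod 2) S where
  carrier := {s | ∃ k, d7 ^ k * s ∈ R}
  mul_mem' := by
    rintro a b ⟨k, hk⟩ ⟨l, hl⟩
    exact ⟨k + l, by convert mul_mem hk hl using 1; ring⟩
  add_mem' := by
    rintro a b ⟨k, hk⟩ ⟨l, hl⟩
    refine ⟨k + l, ?_⟩
    convert add_mem (mul_mem (pow_mem d7_mem_R l) hk) (mul_mem (pow_mem d7_mem_R k) hl) using 1
    ring
  algebraMap_mem' a := ⟨0, mul_mem (pow_mem d7_mem_R 0) (R.algebraMap_mem a)⟩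

theorem R_le_Rsat : R ≤ Rsat := fun r hr => ⟨0, by simpa using hr⟩

theorem invXYZ_le_Rsat : invXYZ ≤ Rsat := by
  rintro f ⟨hf, hw⟩
  replace hw : dropW f = f := hw
  obtain ⟨hA, hB⟩ := mem_invariantRing_L32.mp hf
  -- Only the first three rows of a matrix act on a polynomial free of `w`.
  have key : ∀ (M : Matrix (Fin 4) (Fin 4) (ZMod 2)) (v : Matrix (Fin 3) (Fin 3) (ZMod 2)),
      Matrix.diagonal ![1, 1, 1, 0] * blk v = Matrix.diagonal ![1, 1, 1, 0] * M →
      lin M f = f → lin (blk v) f = f := by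
    intro M v h hM
    conv_lhs => rw [← hw, dropW, ← lin_mul, h, lin_mul, ← dropW, hw, hM]
  have h := d7_pow_three_mul_mem (A := R.comap dropW)
    (show dropW d4 ∈ R from dropW_d4.symm ▸ d4_mem_R)
    (show dropW d6 ∈ R from dropW_d6.symm ▸ d6_mem_R)
    (show dropW d7 ∈ R from dropW_d7.symm ▸ d7_mem_R)
    (show dropW (X 3) ∈ R from dropW_X_three.symm ▸ zero_mem R)
    (key matA.val blockA (by decide) hA) (key matB.val blockB (by decide) hB)
  refine ⟨3, ?_⟩
  rw [Subalgebra.mem_comap, map_mul, map_pow, dropW_d7, hw] at h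
  exact h

/-! ### Invariants as polynomials in `a8` -/

/-- The substitution `w ↦ a8`. -/
noncomputable def substA8 : S →ₐ[ZMod 2] S := aeval ![X 0, X 1, X 2, a8]

theorem substA8_X_zero : substA8 (X 0) = X 0 := by simp [substA8]
theorem substA8_X_one : substA8 (X 1) = X 1 := by simp [substA8]
theorem substA8_X_two : substA8 (X 2) = X 2 := by simp [substA8]
theorem substA8_X_three : substA8 (X 3) = a8 := by simp [substA8]
theorem substA8_q2 : substA8 q2 = q2 := by simp [q2, substA8_X_one, substA8_X_two]
theorem substA8_c3 : substA8 c3 = c3 := by simp [c3, substA8_X_one, substA8_X_two]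
theorem substA8_e4 : substA8 e4 = e4 := by simp [e4, substA8_q2, substA8_c3, substA8_X_zero]
theorem substA8_d4 : substA8 d4 = d4 := by simp [d4_eq, substA8_q2, substA8_e4]
theorem substA8_d6 : substA8 d6 = d6 := by simp [d6_eq, substA8_q2, substA8_c3, substA8_e4]
theorem substA8_d7 : substA8 d7 = d7 := by simp [d7_eq, substA8_c3, substA8_e4]
theorem substA8_p8 : substA8 (p8 (X 0) (X 1) (X 2)) = p8 (X 0) (X 1) (X 2) := by
  rw [map_p8, substA8_X_zero, substA8_X_one, substA8_X_two]

/-- The variable `w` is algebraic over 𝔽₂[x, y, z, `a8`], being a root of a linear polynomial with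
leading coefficient `d7 ≠ 0`. -/
theorem substA8_injective : Function.Injective substA8 := by
  refine algebraicIndependent_of_isAlgebraic_X ![X 0, X 1, X 2, a8] fun i => ?_
  set A := Algebra.adjoin (ZMod 2) (Set.range ![(X 0 : S), X 1, X 2, a8])
  have h0 : (X 0 : S) ∈ A := Algebra.subset_adjoin ⟨0, rfl⟩
  have h1 : (X 1 : S) ∈ A := Algebra.subset_adjoin ⟨1, rfl⟩
  have h2 : (X 2 : S) ∈ A := Algebra.subset_adjoin ⟨2, rfl⟩
  have h8 : a8 ∈ A := Algebra.subset_adjoin ⟨3, rfl⟩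
  have h7 : d7 ∈ A := by
    have hq : q2 ∈ A := add_mem (add_mem (pow_mem h1 2) (mul_mem h1 h2)) (pow_mem h2 2)
    have hc : c3 ∈ A := mul_mem (mul_mem h1 h2) (add_mem h1 h2)
    rw [d7_eq]
    exact mul_mem hc (add_mem (add_mem (pow_mem h0 4) (mul_mem hq (pow_mem h0 2))) (mul_mem hc h0))
  have hp : p8 (X 0) (X 1) (X 2) ∈ A :=
    (map_p8 A.val ⟨X 0, h0⟩ ⟨X 1, h1⟩ ⟨X 2, h2⟩) ▸ Subtype.property _
  have h3 : IsAlgebraic A (X 3 : S) := by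
    refine ⟨Polynomial.C ⟨d7, h7⟩ * Polynomial.X + Polynomial.C ⟨_, add_mem hp h8⟩, ?_, ?_⟩
    · intro h
      have := congrArg (fun p => p.coeff 1) h
      simp only [Polynomial.coeff_add, Polynomial.coeff_C_mul, Polynomial.coeff_X_one,
        Polynomial.coeff_C_succ, mul_one, add_zero, Polynomial.coeff_zero] at this
      exact d7_ne_zero (congrArg Subtype.val this)
    · simp only [map_add, map_mul, Polynomial.aeval_C, Polynomial.aeval_X,
        Subalgebra.algebraMap_apply, a8]
      grind
  fin_cases i
  · exact isAlgebraic_algebraMap (⟨X 0, h0⟩ : A)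
  · exact isAlgebraic_algebraMap (⟨X 1, h1⟩ : A)
  · exact isAlgebraic_algebraMap (⟨X 2, h2⟩ : A)
  · exact h3

theorem exists_d7_pow_mul_eq_substA8 (f : S) : ∃ n c, d7 ^ n * f = substA8 c := by
  induction f using MvPolynomial.induction_on with
  | C a => exact ⟨0, C a, by rw [pow_zero, one_mul, algHom_C, algebraMap_eq]⟩
  | add f g hf hg =>
    obtain ⟨n, c, hc⟩ := hf
    obtain ⟨m, d, hd⟩ := hg
    refine ⟨n + m, d7 ^ m * c + d7 ^ n * d, ?_⟩
    rw [map_add, map_mul, map_mul, map_pow, map_pow, substA8_d7, ← hc, ← hd]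
    ring
  | mul_X f i hf =>
    obtain ⟨n, c, hc⟩ := hf
    have key : ∃ t, d7 * X i = substA8 t := by
      fin_cases i
      · exact ⟨d7 * X 0, by rw [map_mul, substA8_d7, substA8_X_zero]; rfl⟩
      · exact ⟨d7 * X 1, by rw [map_mul, substA8_d7, substA8_X_one]; rfl⟩
      · exact ⟨d7 * X 2, by rw [map_mul, substA8_d7, substA8_X_two]; rfl⟩
      · refine ⟨X 3 + p8 (X 0) (X 1) (X 2), ?_⟩
        rw [map_add, substA8_X_three, substA8_p8, a8]
        change d7 * X 3 = _
        grind
    obtain ⟨t, ht⟩ := key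
    refine ⟨n + 1, c * t, ?_⟩
    rw [map_mul, ← hc, ← ht]
    ring

/-- As `a8` is invariant, the action becomes block diagonal once `a8` replaces `w`. -/
theorem lin_matA_substA8 (c : S) : lin matA.val (substA8 c) = substA8 (lin (blk blockA) c) := by
  have h : (lin matA.val).comp substA8 = substA8.comp (lin (blk blockA)) := by
    ext1 i
    simp only [AlgHom.comp_apply]
    fin_cases i
    · change lin matA.val (substA8 (X 0)) = substA8 (lin (blk blockA) (X 0))
      simp [substA8_X_zero, substA8_X_one, substA8_X_two, lin_matA_X.1, lin_X, blk, blockA,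
        Fin.sum_univ_four]
    · change lin matA.val (substA8 (X 1)) = substA8 (lin (blk blockA) (X 1))
      simp [substA8_X_zero, substA8_X_one, substA8_X_two, lin_matA_X.2.1, lin_X, blk, blockA,
        Fin.sum_univ_four]
    · change lin matA.val (substA8 (X 2)) = substA8 (lin (blk blockA) (X 2))
      simp [substA8_X_zero, substA8_X_one, substA8_X_two, lin_matA_X.2.2.1, lin_X, blk, blockA,
        Fin.sum_univ_four]
    · change lin matA.val (substA8 (X 3)) = substA8 (lin (blk blockA) (X 3))
      rw [lin_blk_X_three, substA8_X_three, (mem_invariantRing_L32.mp a8_mem_invariantRing).1]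
  exact congrArg (fun φ => φ c) h

theorem lin_matB_substA8 (c : S) : lin matB.val (substA8 c) = substA8 (lin (blk blockB) c) := by
  have h : (lin matB.val).comp substA8 = substA8.comp (lin (blk blockB)) := by
    ext1 i
    simp only [AlgHom.comp_apply]
    fin_cases i
    · change lin matB.val (substA8 (X 0)) = substA8 (lin (blk blockB) (X 0))
      simp [substA8_X_zero, substA8_X_two, lin_matB_X.1, lin_X, blk, blockB,
        Fin.sum_univ_four]
    · change lin matB.val (substA8 (X 1)) = substA8 (lin (blk blockB) (X 1))
      simp [substA8_X_one, lin_matB_X.2.1, lin_X, blk, blockB,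
        Fin.sum_univ_four]
    · change lin matB.val (substA8 (X 2)) = substA8 (lin (blk blockB) (X 2))
      simp [substA8_X_zero, substA8_X_one, substA8_X_two, lin_matB_X.2.2.1, lin_X, blk, blockB,
        Fin.sum_univ_four]
    · change lin matB.val (substA8 (X 3)) = substA8 (lin (blk blockB) (X 3))
      rw [lin_blk_X_three, substA8_X_three, (mem_invariantRing_L32.mp a8_mem_invariantRing).2]
  exact congrArg (fun φ => φ c) h

/-- Up to powers of `d₇`, the invariants are polynomials in `d₄, d₆, d₇, a8`. -/
theorem exists_d7_pow_mul_mem_adjoin {f : S} (hf : f ∈ invariantRing L32) :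
    ∃ n, d7 ^ n * f ∈ Algebra.adjoin (ZMod 2) {d4, d6, d7, a8} := by
  obtain ⟨n, c, hc⟩ := exists_d7_pow_mul_eq_substA8 f
  obtain ⟨hA, hB⟩ := mem_invariantRing_L32.mp
    (mul_mem (pow_mem d7_mem_invariantRing n) hf)
  rw [hc, lin_matA_substA8] at hA
  rw [hc, lin_matB_substA8] at hB
  set B := Algebra.adjoin (ZMod 2) {d4, d6, d7, a8}
  have h4 : substA8 d4 ∈ B := substA8_d4.symm ▸ Algebra.subset_adjoin (by simp)
  have h6 : substA8 d6 ∈ B := substA8_d6.symm ▸ Algebra.subset_adjoin (by simp)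
  have h7 : substA8 d7 ∈ B := substA8_d7.symm ▸ Algebra.subset_adjoin (by simp)
  have h8 : substA8 (X 3) ∈ B := substA8_X_three.symm ▸ Algebra.subset_adjoin (by simp)
  have h := d7_pow_three_mul_mem (A := B.comap substA8) h4 h6 h7 h8
    (substA8_injective hA) (substA8_injective hB)
  refine ⟨3 + n, ?_⟩
  rw [Subalgebra.mem_comap, map_mul, map_pow, substA8_d7, ← hc] at h
  rwa [pow_add, mul_assoc]

/-! ### Multiplicative relations -/

theorem a8_sq : ∃ α ∈ invXYZ, a8 ^ 2 = d7 * a9 + α := by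
  refine ⟨a8 ^ 2 + d7 * a9, ⟨add_mem (pow_mem a8_mem_invariantRing 2)
    (mul_mem d7_mem_invariantRing a9_mem_invariantRing), ?_⟩, by grind⟩
  have h : a8 ^ 2 + d7 * a9 = p8 (X 0) (X 1) (X 2) ^ 2 + d7 * p9 (X 0) (X 1) (X 2) := by
    rw [a9_eq, a8]
    grind
  rw [SetLike.mem_coe, AlgHom.mem_equalizer, AlgHom.id_apply]
  rw [h, map_add, map_mul, map_pow, dropW_p8, dropW_p9, dropW_d7]

theorem a9_sq : ∃ β ∈ invXYZ, a9 ^ 2 = d7 * a11 + β := by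
  refine ⟨a9 ^ 2 + d7 * a11, ⟨add_mem (pow_mem a9_mem_invariantRing 2)
    (mul_mem d7_mem_invariantRing a11_mem_invariantRing), ?_⟩, by grind⟩
  have h : a9 ^ 2 + d7 * a11 = p9 (X 0) (X 1) (X 2) ^ 2 + d7 * p11 (X 0) (X 1) (X 2) := by
    rw [a9_eq, a11_eq]
    grind
  rw [SetLike.mem_coe, AlgHom.mem_equalizer, AlgHom.id_apply]
  rw [h, map_add, map_mul, map_pow, dropW_p9, dropW_p11, dropW_d7]

/-- The term `d7 ^ 2 * w ^ 8` of the square is rewritten through `d8`; the resulting powers `w⁴, w²,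
w` are absorbed by `a11, a9, a8`. -/
theorem a11_sq : ∃ γ ∈ invXYZ,
    a11 ^ 2 = d7 ^ 2 * d8 + d4 * d7 * a11 + d6 * d7 * a9 + d7 ^ 2 * a8 + γ := by
  refine ⟨a11 ^ 2 + (d7 ^ 2 * d8 + d4 * d7 * a11 + d6 * d7 * a9 + d7 ^ 2 * a8),
    ⟨add_mem (pow_mem a11_mem_invariantRing 2) (add_mem (add_mem (add_mem
      (mul_mem (pow_mem d7_mem_invariantRing 2) d8_mem_invariantRing)
      (mul_mem (mul_mem d4_mem_invariantRing d7_mem_invariantRing) a11_mem_invariantRing))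
      (mul_mem (mul_mem d6_mem_invariantRing d7_mem_invariantRing) a9_mem_invariantRing))
      (mul_mem (pow_mem d7_mem_invariantRing 2) a8_mem_invariantRing)), ?_⟩, by grind⟩
  have h : a11 ^ 2 + (d7 ^ 2 * d8 + d4 * d7 * a11 + d6 * d7 * a9 + d7 ^ 2 * a8) =
      p11 (X 0) (X 1) (X 2) ^ 2 + d7 ^ 2 * d4 ^ 2 + d4 * d7 * p11 (X 0) (X 1) (X 2)
        + d6 * d7 * p9 (X 0) (X 1) (X 2) + d7 ^ 2 * p8 (X 0) (X 1) (X 2) := by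
    rw [a9_eq, a11_eq, a8, d8]
    grind
  rw [SetLike.mem_coe, AlgHom.mem_equalizer, AlgHom.id_apply]
  rw [h]
  simp only [map_add, map_mul, map_pow, dropW_p8, dropW_p9, dropW_p11, dropW_d7, dropW_d4, dropW_d6]

theorem Sq_two_a8_mem : Sq 2 a8 ∈ invXYZ := by
  refine ⟨Sq_mem_invariantRing a8_mem_invariantRing 2, ?_⟩
  rw [SetLike.mem_coe, AlgHom.mem_equalizer, AlgHom.id_apply]
  rw [a8, Sq_add, Sq_two_mul, Sq_two_X, Sq_one_d7, Sq_two_d7, mul_zero, zero_mul, zero_mul,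
    zero_add, zero_add, zero_add, dropW_Sq, dropW_p8]

theorem Sq_one_a9_mem : Sq 1 a9 ∈ invXYZ := by
  refine ⟨Sq_mem_invariantRing a9_mem_invariantRing 1, ?_⟩
  rw [SetLike.mem_coe, AlgHom.mem_equalizer, AlgHom.id_apply]
  rw [a9_eq, Sq_add, Sq_one_mul, Sq_one_sq, Sq_one_d7, mul_zero, zero_mul, zero_add, zero_add,
    dropW_Sq, dropW_p9]

theorem Sq_one_a11_mem : Sq 1 a11 ∈ invXYZ := by
  refine ⟨Sq_mem_invariantRing a11_mem_invariantRing 1, ?_⟩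
  rw [SetLike.mem_coe, AlgHom.mem_equalizer, AlgHom.id_apply]
  rw [a11_eq, Sq_add, Sq_one_mul, Sq_one_four, Sq_one_d7, mul_zero, zero_mul, zero_add, zero_add,
    dropW_Sq, dropW_p11]

theorem Sq_two_a11_mem : Sq 2 a11 ∈ invXYZ := by
  refine ⟨Sq_mem_invariantRing a11_mem_invariantRing 2, ?_⟩
  rw [SetLike.mem_coe, AlgHom.mem_equalizer, AlgHom.id_apply]
  rw [a11_eq, Sq_add, Sq_two_mul, Sq_two_four, Sq_one_d7, Sq_two_d7, mul_zero, zero_mul, zero_mul,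
    zero_add, zero_add, zero_add, dropW_Sq, dropW_p11]

/-- The Cartan formula for `Sq 2` applied to `d7_mul_a10`; applying `Sq 1` to the outcome gives the
next relation. -/
theorem a8_mul_a11 : a8 * a11 =
    d7 * a12 + d6 * Sq 2 a11 + d7 * Sq 1 a11 + (Sq 2 a8 + Sq 1 a9) * a9 := by
  have h := congrArg (Sq 2) d7_mul_a10
  rw [Sq_add, Sq_two_mul, Sq_two_mul, Sq_two_mul, Sq_one_d7, Sq_two_d7, Sq_one_d6, Sq_two_d6,
    ← a9, ← a11, ← a12] at h
  grind

theorem a9_mul_a11 : a9 * a11 =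
    d7 * a13 + (a8 * Sq 1 a11 + d6 * Sq 1 (Sq 2 a11) + d7 * Sq 2 a11 + d7 * Sq 1 (Sq 1 a11)
      + (Sq 2 a8 + Sq 1 a9) * Sq 1 a9 + Sq 1 (Sq 2 a8 + Sq 1 a9) * a9) := by
  have h := congrArg (Sq 1) a8_mul_a11
  rw [Sq_one_mul, Sq_add, Sq_add, Sq_add, Sq_one_mul, Sq_one_mul, Sq_one_mul, Sq_one_mul, Sq_one_d7,
    Sq_one_d6, ← a9, ← a13] at h
  grind

/-! ### Generation -/

/-- An `R`-module that is saturated with respect to `d₇` and contains the eight generators contains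
all the invariants. -/
theorem invariantRing_le_of_saturated (W : Submodule R S) (hd : ∀ s, d7 * s ∈ W → s ∈ W)
    (h1 : 1 ∈ W) (h8 : a8 ∈ W) (h9 : a9 ∈ W) (h10 : a10 ∈ W) (h11 : a11 ∈ W) (h12 : a12 ∈ W)
    (h13 : a13 ∈ W) (h21 : a10 * a11 ∈ W ∨ a8 * a13 ∈ W) {f : S} (hf : f ∈ invariantRing L32) :
    f ∈ W := by
  have hdpow : ∀ k s, d7 ^ k * s ∈ W → s ∈ W := by
    intro k
    induction k with
    | zero => simp
    | succ k ih =>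
      intro s hs
      rw [pow_succ, mul_assoc] at hs
      exact hd _ (ih _ hs)
  -- Saturation makes `W` a module over the larger ring `Rsat`, which contains every invariant free
  -- of `w`.
  have hR : ∀ r ∈ Rsat, ∀ s ∈ W, r * s ∈ W := by
    rintro r ⟨k, hk⟩ s hs
    refine hdpow k _ ?_
    rw [← mul_assoc]
    exact W.smul_mem ⟨_, hk⟩ hs
  have hJ : ∀ {r}, r ∈ invXYZ → r ∈ Rsat := fun h => invXYZ_le_Rsat h
  have k4 := R_le_Rsat d4_mem_R
  have k6 := R_le_Rsat d6_mem_R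
  have k7 := R_le_Rsat d7_mem_R
  have k8 := R_le_Rsat d8_mem_R
  have kSq : Sq 2 a8 + Sq 1 a9 ∈ invXYZ := add_mem Sq_two_a8_mem Sq_one_a9_mem
  have hone : ∀ r ∈ Rsat, r ∈ W := fun r hr => by simpa using hR r hr 1 h1
  obtain ⟨α, hα, e8⟩ := a8_sq
  obtain ⟨β, hβ, e9⟩ := a9_sq
  obtain ⟨γ, hγ, e11⟩ := a11_sq
  have h89 : a8 * a9 ∈ W := by
    rw [show a8 * a9 = d7 * a10 + d6 * a11 by rw [d7_mul_a10]; grind]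
    exact add_mem (hR _ k7 _ h10) (hR _ k6 _ h11)
  have h811 : a8 * a11 ∈ W := by
    rw [a8_mul_a11]
    exact add_mem (add_mem (add_mem (hR _ k7 _ h12)
      (hone _ (mul_mem k6 (hJ Sq_two_a11_mem)))) (hone _ (mul_mem k7 (hJ Sq_one_a11_mem))))
      (hR _ (hJ kSq) _ h9)
  have h911 : a9 * a11 ∈ W := by
    rw [a9_mul_a11]
    refine add_mem (hR _ k7 _ h13) (add_mem (add_mem (add_mem (add_mem (add_mem ?_ ?_) ?_) ?_) ?_)
      ?_)
    · rw [mul_comm]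
      exact hR _ (hJ Sq_one_a11_mem) _ h8
    · exact hone _ (mul_mem k6 (hJ (Sq_mem_invXYZ Sq_two_a11_mem 1)))
    · exact hone _ (mul_mem k7 (hJ Sq_two_a11_mem))
    · exact hone _ (mul_mem k7 (hJ (Sq_mem_invXYZ Sq_one_a11_mem 1)))
    · exact hone _ (mul_mem (hJ kSq) (hJ Sq_one_a9_mem))
    · exact hR _ (hJ (Sq_mem_invXYZ kSq 1)) _ h9
  -- The triple product is expanded from `a8 * a9` when `a10 * a11` is available, and from `a9 *
  -- a11` when `a8 * a13` is.
  have h8911 : a8 * a9 * a11 ∈ W := by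
    rcases h21 with h | h
    · rw [show a8 * a9 * a11 = d7 * (a10 * a11) + d6 * a11 ^ 2 by
        rw [← mul_assoc, d7_mul_a10]; grind, e11]
      refine add_mem (hR _ k7 _ h) (hR _ k6 _ ?_)
      exact add_mem (add_mem (add_mem (add_mem (hone _ (mul_mem (pow_mem k7 2) k8))
        (hR _ (mul_mem k4 k7) _ h11)) (hR _ (mul_mem k6 k7) _ h9)) (hR _ (pow_mem k7 2) _ h8))
        (hone _ (hJ hγ))
    · have e : a8 * a9 * a11 = d7 * (a8 * a13) + Sq 1 a11 * (d7 * a9 + α)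
          + (d6 * Sq 1 (Sq 2 a11) + d7 * Sq 2 a11 + d7 * Sq 1 (Sq 1 a11)
            + (Sq 2 a8 + Sq 1 a9) * Sq 1 a9) * a8 + Sq 1 (Sq 2 a8 + Sq 1 a9) * (a8 * a9) := by
        rw [← e8, mul_assoc, a9_mul_a11]
        ring
      rw [e]
      refine add_mem (add_mem (add_mem (hR _ k7 _ h) (hR _ (hJ Sq_one_a11_mem) _
        (add_mem (hR _ k7 _ h9) (hone _ (hJ hα))))) (hR _ ?_ _ h8))
        (hR _ (hJ (Sq_mem_invXYZ kSq 1)) _ h89)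
      exact add_mem (add_mem (add_mem (mul_mem k6 (hJ (Sq_mem_invXYZ Sq_two_a11_mem 1)))
        (mul_mem k7 (hJ Sq_two_a11_mem))) (mul_mem k7 (hJ (Sq_mem_invXYZ Sq_one_a11_mem 1))))
        (mul_mem (hJ kSq) (hJ Sq_one_a9_mem))
  let T : Submodule Rsat S := Submodule.span Rsat
    {1, a8, a9, a8 * a9, a11, a8 * a11, a9 * a11, a8 * a9 * a11}
  have hTW : ∀ t ∈ T, t ∈ W := by
    intro t ht
    induction ht using Submodule.span_induction with
    | mem t ht =>
      rcases ht with rfl | rfl | rfl | rfl | rfl | rfl | rfl | rfl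
      exacts [h1, h8, h9, h89, h11, h811, h911, h8911]
    | zero => exact zero_mem W
    | add s t _ _ hs ht => exact add_mem hs ht
    | smul r t _ ht => exact hR _ r.2 _ ht
  have hT : ∀ r ∈ Rsat, ∀ t ∈ T, r * t ∈ T := fun r hr t ht => T.smul_mem ⟨r, hr⟩ ht
  have t1 : 1 ∈ T := Submodule.subset_span (by simp)
  have t8 : a8 ∈ T := Submodule.subset_span (by simp)
  have t9 : a9 ∈ T := Submodule.subset_span (by simp)
  have t89 : a8 * a9 ∈ T := Submodule.subset_span (by simp)
  have t11 : a11 ∈ T := Submodule.subset_span (by simp)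
  have t811 : a8 * a11 ∈ T := Submodule.subset_span (by simp)
  have t911 : a9 * a11 ∈ T := Submodule.subset_span (by simp)
  have t8911 : a8 * a9 * a11 ∈ T := Submodule.subset_span (by simp)
  -- Squares cascade: that of `a8` produces `a9`, that of `a9` produces `a11`, and that of `a11` is
  -- linear in `a8, a9, a11` over `Rsat`.
  have hT8 : ∀ t ∈ T, a8 * t ∈ T := by
    intro t ht
    induction ht using Submodule.span_induction with
    | mem t ht =>
      rcases ht with rfl | rfl | rfl | rfl | rfl | rfl | rfl | rfl
      · rwa [mul_one]
      · rw [← pow_two, e8, ← mul_one α]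
        exact add_mem (hT _ k7 _ t9) (hT _ (hJ hα) _ t1)
      · exact t89
      · rw [show a8 * (a8 * a9) = d7 ^ 2 * a11 + (d7 * β) * 1 + α * a9 by
          linear_combination a9 * e8 + d7 * e9]
        exact add_mem (add_mem (hT _ (pow_mem k7 2) _ t11) (hT _ (mul_mem k7 (hJ hβ)) _ t1))
          (hT _ (hJ hα) _ t9)
      · exact t811
      · rw [show a8 * (a8 * a11) = d7 * (a9 * a11) + α * a11 by linear_combination a11 * e8]
        exact add_mem (hT _ k7 _ t911) (hT _ (hJ hα) _ t11)
      · rwa [← mul_assoc]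
      · rw [show a8 * (a8 * a9 * a11) = d7 ^ 2 * ((d7 ^ 2 * d8 + γ) * 1 + (d4 * d7) * a11
            + (d6 * d7) * a9 + d7 ^ 2 * a8) + (d7 * β) * a11 + α * (a9 * a11) by
          linear_combination a9 * a11 * e8 + d7 * a11 * e9 + d7 ^ 2 * e11]
        exact add_mem (add_mem (hT _ (pow_mem k7 2) _ (add_mem (add_mem (add_mem
          (hT _ (add_mem (mul_mem (pow_mem k7 2) k8) (hJ hγ)) _ t1) (hT _ (mul_mem k4 k7) _ t11))
          (hT _ (mul_mem k6 k7) _ t9)) (hT _ (pow_mem k7 2) _ t8)))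
          (hT _ (mul_mem k7 (hJ hβ)) _ t11)) (hT _ (hJ hα) _ t911)
    | zero => rw [mul_zero]; exact zero_mem T
    | add s t _ _ hs ht => rw [mul_add]; exact add_mem hs ht
    | smul r t _ ht => rw [mul_smul_comm]; exact T.smul_mem r ht
  have hB : ∀ b ∈ Algebra.adjoin (ZMod 2) {d4, d6, d7, a8}, ∀ t ∈ T, b * t ∈ T := by
    intro b hb
    induction hb using Algebra.adjoin_induction with
    | mem b hb =>
      rcases hb with rfl | rfl | rfl | rfl
      exacts [hT _ k4, hT _ k6, hT _ k7, hT8]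
    | algebraMap a => exact hT _ (Rsat.algebraMap_mem a)
    | add a b _ _ ha hb =>
      intro t ht
      rw [add_mul]
      exact add_mem (ha t ht) (hb t ht)
    | mul a b _ _ ha hb =>
      intro t ht
      rw [mul_assoc]
      exact ha _ (hb t ht)
  obtain ⟨n, hn⟩ := exists_d7_pow_mul_mem_adjoin hf
  refine hdpow n f (hTW _ ?_)
  simpa using hB _ hn 1 t1

/-! ### Descent along `d7` and freeness -/

theorem eq_zero_of_forall_d7_pow_dvd {s : S} (h : ∀ n, d7 ^ n ∣ s) : s = 0 := by
  by_contra hs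
  have hu : ¬ IsUnit d7 := fun hu => by
    have := hu.map rho
    rw [rho_d7] at this
    exact not_isUnit_zero this
  obtain ⟨n, hn⟩ := FiniteMultiplicity.of_not_isUnit hu hs
  exact hn (h _)

/-- A family of invariants whose reductions modulo `x` are pairwise incongruent monomials is a basis
as soon as it generates the invariants up to saturation. -/
theorem isFreeOn_of_rho_eq_monomial {ι : Type} [Fintype ι] (b : ι → S) (e : ι → Fin 3 →₀ ℕ)
    (he : ∀ i j, (∀ k, e i k % 2 = e j k % 2) → i = j)
    (hrho : ∀ i, rho (b i) = aeval ![q2, c3, f4] (monomial (e i) (1 : ZMod 2)))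
    (hb : ∀ i, b i ∈ invariantRing L32)
    (hgen : ∀ W : Submodule R S, (∀ s, d7 * s ∈ W → s ∈ W) → (∀ i, b i ∈ W) →
      ∀ f ∈ invariantRing L32, f ∈ W) :
    IsFreeOn (invariantRing L32) b := by
  have key : ∀ g : ι → R, rho (∑ i, g i • b i) = 0 → ∃ g' : ι → R, ∀ i, (g i : S) = d7 * g' i := by
    intro g hg
    choose s hs h using exists_eq_d7_mul_of_rho_sum_eq_zero e he b hrho (fun i => (g i : S))
      (fun i => (g i).2) hg
    exact ⟨fun i => ⟨s i, hs i⟩, h⟩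
  have hdiv : ∀ g g' : ι → R, (∀ i, (g i : S) = d7 * g' i) →
      ∑ i, g i • b i = d7 * ∑ i, g' i • b i := by
    intro g g' h
    rw [Finset.mul_sum]
    refine Finset.sum_congr rfl fun i _ => ?_
    rw [Subalgebra.smul_def, Subalgebra.smul_def, h i, smul_eq_mul, smul_eq_mul, mul_assoc]
  refine ⟨Fintype.linearIndependent_iff.mpr fun g hg i => ?_, Set.Subset.antisymm ?_ fun f hf => ?_⟩
  -- Infinite descent: a relation divided by `d7` is again a relation with coefficients in `R`.
  · have hpow : ∀ n, ∀ g : ι → R, ∑ i, g i • b i = 0 → d7 ^ n ∣ (g i : S) := by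
      intro n
      induction n with
      | zero => simp
      | succ n ih =>
        intro g hg
        obtain ⟨g', hg'⟩ := key g (by rw [hg, map_zero])
        have h0 := hdiv g g' hg'
        rw [hg, zero_eq_mul] at h0
        rw [hg' i, pow_succ']
        exact mul_dvd_mul_left _ (ih g' (h0.resolve_left d7_ne_zero))
    exact Subtype.ext (eq_zero_of_forall_d7_pow_dvd fun n => hpow n g hg)
  · intro f hf
    obtain ⟨g, rfl⟩ := (Submodule.mem_span_range_iff_exists_fun R).mp hf
    exact sum_mem fun i _ => mul_mem (R_le_invariantRing (g i).2) (hb i)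
  -- The span is saturated: an expansion of `d7 * s` vanishes modulo `x`, so its coefficients can be
  -- divided by `d7`.
  · refine hgen (Submodule.span R (Set.range b)) (fun s hs => ?_)
      (fun i => Submodule.subset_span ⟨i, rfl⟩) f hf
    obtain ⟨g, hg⟩ := (Submodule.mem_span_range_iff_exists_fun R).mp hs
    obtain ⟨g', hg'⟩ := key g (by rw [hg]; exact rho_eq_zero_of_dvd (dvd_mul_right _ _))
    rw [hdiv g g' hg'] at hg
    exact (Submodule.mem_span_range_iff_exists_fun R).mpr ⟨g', mul_left_cancel₀ d7_ne_zero hg⟩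

/-- The exponents of the reductions modulo `x` of the basis of the invariants. -/
def basisExponents : Fin 8 → Fin 3 → ℕ :=
  ![![0, 0, 0], ![1, 2, 0], ![0, 3, 0], ![0, 2, 1], ![1, 3, 0], ![1, 2, 1], ![0, 3, 1], ![1, 5, 1]]

theorem isFreeOn_of_a21 (a21 : S) (hmem : a21 ∈ invariantRing L32)
    (hrho : rho a21 = q2 * c3 ^ 5 * f4) (h21 : a21 = a10 * a11 ∨ a21 = a8 * a13) :
    IsFreeOn (invariantRing L32) ![1, a8, a9, a10, a11, a12, a13, a21] := by
  refine isFreeOn_of_rho_eq_monomial _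
    (fun i => Finsupp.equivFunOnFinite.symm (basisExponents i)) ?_ ?_ ?_ ?_
  · change ∀ i j, (∀ k, basisExponents i k % 2 = basisExponents j k % 2) → i = j
    -- The eight exponent vectors hit each class modulo 2 exactly once.
    decide
  · intro i
    rw [aeval_monomial, Finsupp.prod_fintype _ _ (by simp), map_one, one_mul, Fin.prod_univ_three]
    fin_cases i <;>
      simp [basisExponents, rho_a8, rho_a9, rho_a10, rho_a11, rho_a12, rho_a13, hrho]
  · intro i
    fin_cases i
    exacts [one_mem _, a8_mem_invariantRing, a9_mem_invariantRing, a10_mem_invariantRing,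
      a11_mem_invariantRing, a12_mem_invariantRing, a13_mem_invariantRing, hmem]
  · intro W hd hW f hf
    have h7 : a21 ∈ W := hW 7
    exact invariantRing_le_of_saturated W hd (hW 0) (hW 1) (hW 2) (hW 3) (hW 4) (hW 5) (hW 6)
      (h21.imp (fun h : a21 = a10 * a11 => h ▸ h7) fun h : a21 = a8 * a13 => h ▸ h7) hf

end InvL32

theorem proposition1p2 :
    (InvL32.d4.IsHomogeneous 4 ∧ InvL32.d6.IsHomogeneous 6 ∧
      InvL32.d7.IsHomogeneous 7 ∧ InvL32.d8.IsHomogeneous 8) ∧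
    AlgebraicIndependent (ZMod 2) ![InvL32.d4, InvL32.d6, InvL32.d7, InvL32.d8] ∧
    InvL32.R ≤ InvL32.invariantRing InvL32.L32 ∧
    ∃ a8 a9 a10 a11 a12 a13 : InvL32.S,
      (a8.IsHomogeneous 8 ∧ a9.IsHomogeneous 9 ∧ a10.IsHomogeneous 10 ∧
        a11.IsHomogeneous 11 ∧ a12.IsHomogeneous 12 ∧ a13.IsHomogeneous 13) ∧
      a9 = InvL32.Sq 1 a8 ∧
      a11 = InvL32.Sq 2 (InvL32.Sq 1 a8) ∧
      a12 = InvL32.Sq 2 a10 ∧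
      a13 = InvL32.Sq 1 (InvL32.Sq 2 a10) ∧
      InvL32.IsFreeOn (InvL32.invariantRing InvL32.L32)
        ![1, a8, a9, a10, a11, a12, a13, a10 * a11] ∧
      InvL32.IsFreeOn (InvL32.invariantRing InvL32.L32)
        ![1, a8, a9, a10, a11, a12, a13, a8 * a13] := by
  refine ⟨⟨InvL32.isHomogeneous_d4, InvL32.isHomogeneous_d6, InvL32.isHomogeneous_d7,
    InvL32.isHomogeneous_d8⟩, InvL32.algebraicIndependent_dickson, InvL32.R_le_invariantRing,
    InvL32.a8, InvL32.a9, InvL32.a10, InvL32.a11, InvL32.a12, InvL32.a13,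
    ⟨InvL32.isHomogeneous_a8, InvL32.isHomogeneous_a9, InvL32.isHomogeneous_a10,
      InvL32.isHomogeneous_a11, InvL32.isHomogeneous_a12, InvL32.isHomogeneous_a13⟩,
    rfl, rfl, rfl, rfl,
    InvL32.isFreeOn_of_a21 _ (mul_mem InvL32.a10_mem_invariantRing InvL32.a11_mem_invariantRing)
      ?_ (Or.inl rfl),
    InvL32.isFreeOn_of_a21 _ (mul_mem InvL32.a8_mem_invariantRing InvL32.a13_mem_invariantRing)
      ?_ (Or.inr rfl)⟩
  · rw [map_mul, InvL32.rho_a10, InvL32.rho_a11]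
    ring
  · rw [map_mul, InvL32.rho_a8, InvL32.rho_a13]
    ring
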